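/- Let $(\bar M,\bar g)$ be a semi-Riemannian manifold with Levi-Civita connection $\bar\nabla$, and let $\bar J$ be a smooth $(1,1)$-tensor field with $\bar J^2=3\bar J+I$, $\bar g(X,\bar JY)=\bar g(\bar JX,Y)$ and $\bar\nabla\bar J=0$ (a locally bronze semi-Riemannian manifold). Let $l,m$ be smooth functions on $\bar M$, not both identically zero, let $\eta$ be a smooth vector field with $\bar g(\eta,\eta)=1$, put $\theta(X)=\bar g(X,\eta)$, and let $\bar\Omega$ be the $(l,m)$-type connection $$\bar\Omega_XY=\bar\nabla_XY+\theta(Y)\{lX+m\bar JX\}.$$ Let $M$ be an immersed lightlike submanifold of $\bar M$: the radical $\mathrm{Rad}(TM)=TM\cap TM^\perp$ is a smooth distribution of constant rank $r>0$. Choose a smooth complement $S(TM)$ of $\mathrm{Rad}(TM)$ in $TM$, a smooth complement $S(TM^\perp)$ of $\mathrm{Rad}(TM)$ in $TM^\perp$, and a lightlike transversal bundle $ltr(TM)$, that is, a smooth totally null complement of $\mathrm{Rad}(TM)$ in the orthogonal complement of $S(TM)\perp S(TM^\perp)$. Then $T\bar M|_M=TM\oplus ltr(TM)\oplus S(TM^\perp)$.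 For a section $V$ of $T\bar M|_M$ write $\bar JV=fV+wV$ with $fV\in\Gamma(TM)$ and $wV\in\Gamma(ltr(TM)\oplus S(TM^\perp))$. For $X,Y\in\Gamma(TM)$ and $W\in\Gamma(S(TM^\perp))$ decompose $$\bar\Omega_XY=\Omega_XY+\bar h^l(X,Y)+\bar h^s(X,Y),\qquad \bar\Omega_XW=-\bar A_WX+\bar\Omega^s_XW+\bar D^l(X,W)$$ into their components, where $\Omega_XY,\bar A_WX\in\Gamma(TM)$, $\bar h^l(X,Y),\bar D^l(X,W)\in\Gamma(ltr(TM))$ and $\bar h^s(X,Y),\bar\Omega^s_XW\in\Gamma(S(TM^\perp))$. Assume that $M$ is screen generic: $\bar J(\mathrm{Rad}(TM))=\mathrm{Rad}(TM)$, the intersection $B_o=\bar J(S(TM))\cap S(TM)$ is a smooth non-degenerate distribution, and $B'$ is a smooth non-degenerate distribution with $S(TM)=B_o\oplus B'$. Put $B=B_o\perp\mathrm{Rad}(TM)$. Then $M$ is mixed geodesic with respect to $\bar\Omega$, i.e. $\bar h^l(X,Z)=\bar h^s(X,Z)=0$ for all $X\in\Gamma(B)$ and $Z\in\Gamma(B')$,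 if and only if for all $X\in\Gamma(B)$, $Z\in\Gamma(B')$, $\xi\in\Gamma(\mathrm{Rad}(TM))$ and $W\in\Gamma(S(TM^\perp))$ both of the following hold: (i) $\bar g(\bar h^l(X,fZ),\xi)+l\,\theta(Z)\,\bar g(\bar JX,\xi)+3m\,\theta(Z)\,\bar g(\bar JX,\xi)+m\,\theta(Z)\,\bar g(X,\xi)=-\bar g(\bar D^l(X,wZ),\xi)+l\,\theta(\bar JZ)\,\bar g(X,\xi)+m\,\theta(\bar JZ)\,\bar g(\bar JX,\xi)$; (ii) $3\,\bar g(\bar h^s(X,fZ)+\bar\Omega^s_X wZ,\,W)+\bar g(\bar A_{wZ}X,\,fW)=\bar g(\Omega_X fZ+\bar h^s(X,fZ),\,\bar JW)+\bar g(\bar\Omega^s_X wZ,\,wW)$. -/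

import Mathlib

open Bundle
open scoped Manifold ContDiff

noncomputable section

namespace LightlikeBronze

/-! ### Semi-Riemannian manifolds and their Levi-Civita connection

Throughout, `N` is the ambient manifold (written `M̄` on paper), modelled on the finite-dimensional
space `E`, and `M`, modelled on `E'`, is immersed in `N` by `i : M → N`. -/

section Ambient

variable {E : Type*} [NormedAddCommGroup E] [NormedSpace ℝ E]
  {N : Type*} [TopologicalSpace N] [ChartedSpace E N] [IsManifold 𝓘(ℝ, E) ∞ N]

variable (E N) in
/-- A smooth semi-Riemannian metric of constant index on `N`: a smooth field of symmetric
nondegenerate bilinear forms; the index at a point is the largest dimension of a subspace on which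
the form is negative definite. -/
structure SemiRiemannianMetric where
  /-- the bilinear form on each tangent space -/
  val (x : N) : TangentSpace 𝓘(ℝ, E) x →L[ℝ] TangentSpace 𝓘(ℝ, E) x →L[ℝ] ℝ
  symm (x : N) (u v : TangentSpace 𝓘(ℝ, E) x) : val x u v = val x v u
  nondegenerate (x : N) (u : TangentSpace 𝓘(ℝ, E) x) (hu : ∀ v, val x u v = 0) : u = 0
  contMDiff : ContMDiff 𝓘(ℝ, E) (𝓘(ℝ, E).prod 𝓘(ℝ, E →L[ℝ] E →L[ℝ] ℝ)) ∞
    (fun x ↦ TotalSpace.mk' (E →L[ℝ] E →L[ℝ] ℝ) x (val x))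
  /-- the index -/
  index : ℕ
  index_spec (x : N) : IsGreatest
    {k : ℕ | ∃ D : Submodule ℝ (TangentSpace 𝓘(ℝ, E) x),
      Module.finrank ℝ D = k ∧ ∀ u ∈ D, u ≠ 0 → val x u u < 0} index

variable (E N) in
/-- Affine connections on `N`, in Mathlib's convention: `∇_v Y` at `x` is `cov Y x v`. -/
abbrev AffineConnection : Type _ :=
  CovariantDerivative 𝓘(ℝ, E) E (TangentSpace 𝓘(ℝ, E) : N → Type _)

variable (E N) in
/-- Fields of endomorphisms of the tangent spaces of `N` (tensor fields of type `(1,1)`). -/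
abbrev EndField : Type _ :=
  (x : N) → TangentSpace 𝓘(ℝ, E) x →L[ℝ] TangentSpace 𝓘(ℝ, E) x

/-- `cov` is the Levi-Civita connection of `g`: it is torsion free and metric. -/
structure IsLeviCivita [FiniteDimensional ℝ E] (g : SemiRiemannianMetric E N)
    (cov : AffineConnection E N) : Prop where
  torsion_free : cov.torsion = 0
  metric : ∀ (x : N) (Y Z : (x : N) → TangentSpace 𝓘(ℝ, E) x),
    MDiffAt (T% Y) x → MDiffAt (T% Z) x → ∀ v : TangentSpace 𝓘(ℝ, E) x,
      mvfderiv 𝓘(ℝ, E) (fun y ↦ g.val y (Y y) (Z y)) x v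
        = g.val x (cov Y x v) (Z x) + g.val x (Y x) (cov Z x v)

/-- `(N, g, J)` is a locally bronze semi-Riemannian manifold: `J` is a smooth tensor field of type
`(1,1)` with `J² = 3J + I`, the metric is `J`-compatible, and `J` is parallel for the
Levi-Civita connection `cov`. -/
structure IsLocallyBronze [FiniteDimensional ℝ E] (g : SemiRiemannianMetric E N)
    (J : EndField E N) (cov : AffineConnection E N) : Prop where
  leviCivita : IsLeviCivita g cov
  contMDiff : ContMDiff 𝓘(ℝ, E) (𝓘(ℝ, E).prod 𝓘(ℝ, E →L[ℝ] E)) ∞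
    (fun x ↦ TotalSpace.mk' (E →L[ℝ] E) x (J x))
  bronze : ∀ (x : N) (u : TangentSpace 𝓘(ℝ, E) x), J x (J x u) = (3 : ℝ) • J x u + u
  compatible : ∀ (x : N) (u v : TangentSpace 𝓘(ℝ, E) x), g.val x u (J x v) = g.val x (J x u) v
  parallel : ∀ (x : N) (Y : (x : N) → TangentSpace 𝓘(ℝ, E) x), MDiffAt (T% Y) x →
    ∀ v : TangentSpace 𝓘(ℝ, E) x, cov (fun y ↦ J y (Y y)) x v = J x (cov Y x v)

/-- The data of an `(l,m)`-type connection: smooth functions `l`, `m`, not both identically zero,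
and a smooth unit spacelike vector field `η`. -/
structure IsLMData (g : SemiRiemannianMetric E N) (l m : N → ℝ)
    (η : (x : N) → TangentSpace 𝓘(ℝ, E) x) : Prop where
  l_contMDiff : ContMDiff 𝓘(ℝ, E) 𝓘(ℝ, ℝ) ∞ l
  m_contMDiff : ContMDiff 𝓘(ℝ, E) 𝓘(ℝ, ℝ) ∞ m
  ne_zero : (l, m) ≠ (0, 0)
  η_contMDiff : ContMDiff 𝓘(ℝ, E) 𝓘(ℝ, E).tangent ∞
    (fun x ↦ (⟨x, η x⟩ : TangentBundle 𝓘(ℝ, E) N))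
  unit_spacelike : ∀ x, g.val x (η x) (η x) = 1

/-- The 1-form `θ(Y) = g(Y, η) = g(η, Y)`. -/
def theta (g : SemiRiemannianMetric E N) (η : (x : N) → TangentSpace 𝓘(ℝ, E) x) (x : N) :
    TangentSpace 𝓘(ℝ, E) x →L[ℝ] ℝ :=
  g.val x (η x)

/-- The `(l,m)`-type connection `Ω̄_X Y = ∇̄_X Y + θ(Y) (l X + m J X)`. -/
def lmConnection (g : SemiRiemannianMetric E N) (J : EndField E N) (cov : AffineConnection E N)
    (l m : N → ℝ) (η : (x : N) → TangentSpace 𝓘(ℝ, E) x) : AffineConnection E N :=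
  cov.addOneForm fun x ↦
    (theta g η x).smulRight
      (l x • ContinuousLinearMap.id ℝ (TangentSpace 𝓘(ℝ, E) x) + m x • J x)

theorem lmConnection_apply (g : SemiRiemannianMetric E N) (J : EndField E N)
    (cov : AffineConnection E N) (l m : N → ℝ) (η Y : (x : N) → TangentSpace 𝓘(ℝ, E) x)
    (x : N) (v : TangentSpace 𝓘(ℝ, E) x) :
    lmConnection g J cov l m η Y x v
      = cov Y x v + theta g η x (Y x) • (l x • v + m x • J x v) :=
  rfl

/-- The torsion of `Ω̄` is the one required of an `(l,m)`-type connection. -/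
theorem lmConnection_torsion [FiniteDimensional ℝ E] (g : SemiRiemannianMetric E N) (J : EndField E N) (cov : AffineConnection E N)
    (h : cov.torsion = 0)
    (l m : N → ℝ) (η : (x : N) → TangentSpace 𝓘(ℝ, E) x) (x : N) (u v : TangentSpace 𝓘(ℝ, E) x) :
    (lmConnection g J cov l m η).torsion x u v
      = l x • (theta g η x v • u - theta g η x u • v)
        + m x • (theta g η x v • J x u - theta g η x u • J x v) := by
  have h0 : cov.torsion x u v = 0 := by rw [h]; rfl
  rw [CovariantDerivative.torsion_apply_eq_extend] at h0 ⊢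
  simp only [lmConnection_apply]
  simp only [FiberBundle.extend_apply_self] at h0 ⊢
  rw [sub_eq_zero] at h0
  rw [← h0]
  module

theorem affineConnection_sum (cov : AffineConnection E N) {ι : Type*} (t : Finset ι) (f : ι → N → ℝ)
    (s : ι → (x : N) → TangentSpace 𝓘(ℝ, E) x) (x : N) (hf : ∀ a, MDiffAt (f a) x)
    (hs : ∀ a, MDiffAt (T% (s a)) x) :
    MDiffAt (T% (∑ a ∈ t, f a • s a)) x ∧ cov (∑ a ∈ t, f a • s a) x
      = ∑ a ∈ t, (f a x • cov (s a) x + (mvfderiv 𝓘(ℝ, E) (f a) x).smulRight (s a x)) := by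
  classical
  induction t using Finset.induction_on with
  | empty => 
    simp only [Finset.sum_empty]
    exact ⟨mdifferentiableAt_zeroSection .., cov.isCovariantDerivativeOnUniv.zero⟩
  | insert a t ha ih =>
    rw [Finset.sum_insert ha, Finset.sum_insert ha]
    have h1 := (hf a).smul_section (hs a)
    refine ⟨mdifferentiableAt_add_section h1 ih.1, ?_⟩
    rw [cov.isCovariantDerivativeOnUniv.add h1 ih.1, ih.2,
      cov.isCovariantDerivativeOnUniv.leibniz (hs a) (hf a)]

end Ambient

/-! ### Fields and distributions along an immersion -/

section Along

variable {E : Type*} [NormedAddCommGroup E] [NormedSpace ℝ E]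
  {N : Type*} [TopologicalSpace N] [ChartedSpace E N] [IsManifold 𝓘(ℝ, E) ∞ N]
  {E' : Type*} [NormedAddCommGroup E'] [NormedSpace ℝ E']
  {M : Type*} [TopologicalSpace M] [ChartedSpace E' M]

variable (E) in
/-- Vector fields along `i`, that is (not necessarily smooth) sections of `TN|_M`. -/
abbrev FieldAlong (i : M → N) : Type _ := (p : M) → TangentSpace 𝓘(ℝ, E) (i p)

variable (E) in
/-- Families of subspaces of the fibres of `TN|_M`. -/
abbrev SubspaceField (i : M → N) : Type _ := (p : M) → Submodule ℝ (TangentSpace 𝓘(ℝ, E) (i p))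

variable (E') in
/-- Smoothness on a subset of `M` of a vector field along `i`. -/
def SmoothAlongOn (i : M → N) (V : FieldAlong E i) (U : Set M) : Prop :=
  ContMDiffOn 𝓘(ℝ, E') 𝓘(ℝ, E).tangent ∞ (fun p ↦ (⟨i p, V p⟩ : TangentBundle 𝓘(ℝ, E) N)) U

variable (E') in
/-- `V ∈ Γ(D)`: a smooth section, on all of `M`, of the family of subspaces `D`. -/
def IsSection {i : M → N} (D : SubspaceField E i) (V : FieldAlong E i) : Prop :=
  SmoothAlongOn E' i V Set.univ ∧ ∀ p, V p ∈ D p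

variable (E') in
/-- `D` is a smooth vector subbundle of `TN|_M`: near every point it is spanned by a
smooth local frame. -/
def IsSmoothSubbundle {i : M → N} (D : SubspaceField E i) : Prop :=
  ∀ p : M, ∃ U ∈ nhds p, ∃ (k : ℕ) (s : Fin k → FieldAlong E i),
    (∀ a, SmoothAlongOn E' i (s a) U) ∧
    ∀ q ∈ U, LinearIndependent ℝ (fun a ↦ s a q) ∧ Submodule.span ℝ (Set.range fun a ↦ s a q) = D q

/-- The tangent spaces of `M` as subspaces of those of `N`. -/
def tangent (E' : Type*) [NormedAddCommGroup E'] [NormedSpace ℝ E'] [ChartedSpace E' M]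
    (i : M → N) : SubspaceField E i :=
  fun p ↦ (mfderiv 𝓘(ℝ, E') 𝓘(ℝ, E) i p).toLinearMap.range

/-- The orthogonal complement of `D` in `TN|_M`. -/
def perp (g : SemiRiemannianMetric E N) {i : M → N} (D : SubspaceField E i) :
    SubspaceField E i := fun p ↦
  { carrier := {v | ∀ u ∈ D p, g.val (i p) u v = 0}
    add_mem' := fun ha hb u hu ↦ by simp [ha u hu, hb u hu]
    zero_mem' := fun u _ ↦ by simp
    smul_mem' := fun c v hv u hu ↦ by simp [hv u hu] }

/-- The restriction of the metric to `D` is nondegenerate. -/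
def IsNondegenerate (g : SemiRiemannianMetric E N) {i : M → N} (D : SubspaceField E i) : Prop :=
  ∀ p, ∀ u ∈ D p, (∀ v ∈ D p, g.val (i p) u v = 0) → u = 0

/-- The radical distribution `Rad TM = TM ∩ TM^⊥`. -/
def radical (E' : Type*) [NormedAddCommGroup E'] [NormedSpace ℝ E'] [ChartedSpace E' M]
    (g : SemiRiemannianMetric E N) (i : M → N) : SubspaceField E i :=
  fun p ↦ tangent E' i p ⊓ perp g (tangent E' i) p

/-- The covariant derivative at `p` of a vector field `V` along `i` in the direction `v ∈ T_pM`, for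
the connection pulled back along `i`. If `V = ∑ₐ Vᵃ (eₐ ∘ i)` near `p`, where `eₐ` is the coordinate
frame of the preferred chart of `N` at `i p`, it is `∑ₐ dVᵃ(v) eₐ + Vᵃ cov_{di(v)} eₐ`. -/
def covAlong [FiniteDimensional ℝ E] (cov : AffineConnection E N) (i : M → N)
    (V : FieldAlong E i) (p : M) (v : TangentSpace 𝓘(ℝ, E') p) : TangentSpace 𝓘(ℝ, E) (i p) :=
  let e := trivializationAt E (TangentSpace 𝓘(ℝ, E) : N → Type _) (i p)
  let b := Module.finBasis ℝ E
  ∑ a, (mvfderiv 𝓘(ℝ, E') (fun q ↦ e.localFrameCoeff 𝓘(ℝ, E) b a (i q) (V q)) p v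
        • e.localFrame b a (i p)
      + e.localFrameCoeff 𝓘(ℝ, E) b a (i p) (V p)
        • cov (e.localFrame b a) (i p) (mfderiv 𝓘(ℝ, E') 𝓘(ℝ, E) i p v))

/-- On restrictions to `M` of vector fields of `N`, `covAlong` is the connection of `N`. -/
theorem covAlong_comp [FiniteDimensional ℝ E] (cov : AffineConnection E N) (i : M → N) (p : M)
    (hi : MDifferentiableAt 𝓘(ℝ, E') 𝓘(ℝ, E) i p) (Y : (x : N) → TangentSpace 𝓘(ℝ, E) x)
    (hY : MDiffAt (T% Y) (i p)) (v : TangentSpace 𝓘(ℝ, E') p) :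
    covAlong cov i (fun q ↦ Y (i q)) p v
      = cov Y (i p) (mfderiv 𝓘(ℝ, E') 𝓘(ℝ, E) i p v) := by
  let e := trivializationAt E (TangentSpace 𝓘(ℝ, E) : N → Type _) (i p)
  let b := Module.finBasis ℝ E
  have hx : i p ∈ e.baseSet := FiberBundle.mem_baseSet_trivializationAt' (i p)
  let f : Fin (Module.finrank ℝ E) → N → ℝ := fun a y ↦ e.localFrameCoeff 𝓘(ℝ, E) b a y (Y y)
  have hf : ∀ a, MDiffAt (f a) (i p) := fun a ↦
    mdifferentiableAt_localFrameCoeff (I := 𝓘(ℝ, E)) b hx hY a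
  have hs : ∀ a, MDiffAt (T% (e.localFrame b a)) (i p) := fun a ↦
    (contMDiffAt_localFrame_of_mem (I := 𝓘(ℝ, E)) 1 e b a hx).mdifferentiableAt (by simp)
  obtain ⟨h1, h2⟩ := affineConnection_sum cov Finset.univ f (fun a ↦ e.localFrame b a) (i p) hf hs
  have h3 : cov Y (i p) = cov (∑ a, f a • e.localFrame b a) (i p) := by
    refine cov.isCovariantDerivativeOnUniv.congr_of_eventuallyEq hY h1 Filter.univ_mem ?_
    filter_upwards [e.eventually_eq_localFrame_sum_coeff_smul (I := 𝓘(ℝ, E)) b hx (s := Y)] with y hy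
    rw [hy]; simp [f]
  rw [h3, h2]
  unfold covAlong
  simp only [sum_apply, add_apply,
    smul_apply, ContinuousLinearMap.smulRight_apply]
  refine Finset.sum_congr rfl fun a _ ↦ ?_
  rw [add_comm]
  congr 2
  have : mfderiv 𝓘(ℝ, E') 𝓘(ℝ, ℝ) (f a ∘ i) p = _ := mfderiv_comp p (hf a) hi
  exact congrArg (fun φ ↦ φ v) this

/-- The function `g(U, V)` on `M`, for vector fields `U`, `V` along `i`. -/
def pairing (g : SemiRiemannianMetric E N) {i : M → N} (U V : FieldAlong E i) : M → ℝ :=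
  fun p ↦ g.val (i p) (U p) (V p)

/-- The field `J V` along `i`. -/
def applyEnd (J : EndField E N) {i : M → N} (V : FieldAlong E i) : FieldAlong E i :=
  fun p ↦ J (i p) (V p)

/-- The function `θ(V)` on `M`, for a vector field `V` along `i`. -/
def thetaAlong (g : SemiRiemannianMetric E N) (η : (x : N) → TangentSpace 𝓘(ℝ, E) x) {i : M → N}
    (V : FieldAlong E i) : M → ℝ :=
  fun p ↦ theta g η (i p) (V p)

/-- A vector field on `M`, seen as the vector field `di(X)` along `i`. -/
def push (i : M → N) (X : (p : M) → TangentSpace 𝓘(ℝ, E') p) : FieldAlong E i :=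
  fun p ↦ mfderiv 𝓘(ℝ, E') 𝓘(ℝ, E) i p (X p)

end Along

/-! ### Lightlike submanifolds -/

section LinearAlgebra

/-- Linear algebra behind `T N|_M = TM ⊕ ltr(TM) ⊕ S(TM^⊥)`. -/
theorem lightlike_decomposition {V : Type*} [AddCommGroup V] [Module ℝ V] [FiniteDimensional ℝ V]
    (B : LinearMap.BilinForm ℝ V) (hs : ∀ u v, B u v = B v u) (hn : ∀ u, (∀ v, B u v = 0) → u = 0)
    {T R S S' L : Submodule ℝ V} (hR : R = T ⊓ B.orthogonal T)
    (hRS : R ⊓ S = ⊥) (hRS' : R ⊔ S = T) (hRW : R ⊓ S' = ⊥) (hRW' : R ⊔ S' = B.orthogonal T)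
    (hRL : R ⊓ L = ⊥) (hRL' : R ⊔ L = B.orthogonal S ⊓ B.orthogonal S') :
    (∀ t ∈ T, ∀ n ∈ L, ∀ w ∈ S', t + n + w = 0 → t = 0 ∧ n = 0 ∧ w = 0) ∧ T ⊔ L ⊔ S' = ⊤ := by
  have hrefl : B.IsRefl := fun u v h ↦ by rw [hs]; exact h
  have hnd : B.Nondegenerate :=
    ⟨hn, fun u h ↦ hn u fun v ↦ by rw [hs]; exact h v⟩
  have hST : S ≤ T := hRS' ▸ le_sup_right
  have hRT : R ≤ T := hRS' ▸ le_sup_left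
  have hRT' : R ≤ B.orthogonal T := hRW' ▸ le_sup_left
  have hWT : S' ≤ B.orthogonal T := hRW' ▸ le_sup_right
  have hLR : R ⊔ L ≤ B.orthogonal S ⊓ B.orthogonal S' := hRL'.le
  have hTT : B.orthogonal (B.orthogonal T) = T := B.orthogonal_orthogonal hnd hrefl T
  have key : ∀ a ∈ S, ∀ w ∈ S', B a w = 0 := fun a ha w hw ↦ hWT hw a (hST ha)
  have nS : ∀ a ∈ S, (∀ c ∈ S, B c a = 0) → a = 0 := by
    intro a ha h
    have : a ∈ R ⊓ S := by
      refine ⟨?_, ha⟩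
      rw [hR]
      refine ⟨hST ha, fun t ht ↦ ?_⟩
      rw [← hRS'] at ht
      obtain ⟨r, hr, c, hc, rfl⟩ := Submodule.mem_sup.1 ht
      have h1 : B r a = 0 := by rw [hs]; exact hRT' hr a (hST ha)
      simp [h1, h c hc]
    simpa [hRS] using this
  have nW : ∀ a ∈ S', (∀ c ∈ S', B c a = 0) → a = 0 := by
    intro a ha h
    have : a ∈ R ⊓ S' := by
      refine ⟨?_, ha⟩
      rw [hR]
      refine ⟨?_, hWT ha⟩
      rw [← hTT]
      intro t ht
      rw [← hRW'] at ht
      obtain ⟨r, hr, c, hc, rfl⟩ := Submodule.mem_sup.1 ht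
      have h1 : B r a = 0 := hWT ha r (hRT hr)
      simp [h1, h c hc]
    simpa [hRW] using this
  have split : ∀ a ∈ S, ∀ w ∈ S', ∀ u ∈ R ⊔ L, a + w + u = 0 → a = 0 ∧ w = 0 ∧ u = 0 := by
    intro a ha w hw u hu h
    have h1 : a = 0 := by
      refine nS a ha fun c hc ↦ ?_
      have := congrArg (B c) h
      simpa [key c hc w hw, (hLR hu).1 c hc] using this
    have h2 : w = 0 := by
      refine nW w hw fun c hc ↦ ?_
      have := congrArg (B c) h
      have h3 : B c a = 0 := by rw [hs]; exact key a ha c hc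
      simpa [h3, (hLR hu).2 c hc] using this
    subst h1 h2
    simpa using h
  constructor
  · intro t ht n hn' w hw h
    rw [← hRS'] at ht
    obtain ⟨r, hr, a, ha, rfl⟩ := Submodule.mem_sup.1 ht
    obtain ⟨h1, h2, h3⟩ := split a ha w hw (r + n)
      (Submodule.add_mem_sup hr hn') (by rw [← h]; abel)
    have hr0 : r ∈ R ⊓ L := ⟨hr, by rw [eq_neg_of_add_eq_zero_left h3]; exact L.neg_mem hn'⟩
    have hr1 : r = 0 := by simpa [hRL] using hr0
    subst hr1
    exact ⟨by simp [h1], by simpa using h3, h2⟩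
  · have hdisj : Disjoint (S ⊔ S') (B.orthogonal (S ⊔ S')) := by
      rw [Submodule.disjoint_def]
      intro x hx hx'
      obtain ⟨a, ha, w, hw, rfl⟩ := Submodule.mem_sup.1 hx
      have hu : -(a + w) ∈ R ⊔ L := by
        rw [hRL']
        refine Submodule.neg_mem _ ⟨fun c hc ↦ hx' c (Submodule.mem_sup_left hc),
          fun c hc ↦ hx' c (Submodule.mem_sup_right hc)⟩
      obtain ⟨h1, h2, -⟩ := split a ha w hw _ hu (by abel)
      simp [h1, h2]
    have hc := (LinearMap.BilinForm.isCompl_orthogonal_iff_disjoint hrefl).2 hdisj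
    have hle : B.orthogonal (S ⊔ S') ≤ R ⊔ L := by
      rw [hRL']
      exact le_inf (LinearMap.BilinForm.orthogonal_le le_sup_left)
        (LinearMap.BilinForm.orthogonal_le le_sup_right)
    rw [eq_top_iff, ← hc.sup_eq_top]
    refine sup_le (sup_le ?_ le_sup_right) (hle.trans (sup_le ?_ ?_))
    · exact hST.trans (le_sup_left.trans le_sup_left)
    · exact hRT.trans (le_sup_left.trans le_sup_left)
    · exact le_sup_right.trans le_sup_left

theorem isCompl_of_decomposition {V : Type*} [AddCommGroup V] [Module ℝ V] {T L S' : Submodule ℝ V}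
    (h : (∀ t ∈ T, ∀ n ∈ L, ∀ w ∈ S', t + n + w = 0 → t = 0 ∧ n = 0 ∧ w = 0) ∧ T ⊔ L ⊔ S' = ⊤) :
    IsCompl T (L ⊔ S') ∧ IsCompl L (T ⊔ S') ∧ IsCompl S' (T ⊔ L) := by
  obtain ⟨h, h'⟩ := h
  refine ⟨⟨?_, ?_⟩, ⟨?_, ?_⟩, ⟨?_, ?_⟩⟩
  · rw [Submodule.disjoint_def]
    intro x hx hx'
    obtain ⟨n, hn, w, hw, rfl⟩ := Submodule.mem_sup.1 hx'
    have := h _ (T.neg_mem hx) n hn w hw (by abel)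
    exact neg_eq_zero.1 this.1
  · rw [codisjoint_iff, ← h', sup_assoc]
  · rw [Submodule.disjoint_def]
    intro x hx hx'
    obtain ⟨t, ht, w, hw, rfl⟩ := Submodule.mem_sup.1 hx'
    have := h t ht _ (L.neg_mem hx) w hw (by abel)
    exact neg_eq_zero.1 this.2.1
  · rw [codisjoint_iff, ← h', ← sup_assoc, sup_comm L T]
  · rw [Submodule.disjoint_def]
    intro x hx hx'
    obtain ⟨t, ht, n, hn, rfl⟩ := Submodule.mem_sup.1 hx'
    have := h t ht n hn _ (S'.neg_mem hx) (by abel)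
    exact neg_eq_zero.1 this.2.2
  · rw [codisjoint_iff, ← h', sup_comm]

end LinearAlgebra

section Lightlike

variable {E : Type*} [NormedAddCommGroup E] [NormedSpace ℝ E]
  {N : Type*} [TopologicalSpace N] [ChartedSpace E N] [IsManifold 𝓘(ℝ, E) ∞ N]
  {E' : Type*} [NormedAddCommGroup E'] [NormedSpace ℝ E']
  {M : Type*} [TopologicalSpace M] [ChartedSpace E' M]

variable (E') in
/-- An `r`-lightlike submanifold `(M, g, S(TM), S(TM^⊥))` of `(N, g)`, immersed by `i`, together
with a lightlike transversal bundle `ltr(TM)`. -/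
structure LightlikeSubmanifold (g : SemiRiemannianMetric E N) (i : M → N) where
  contMDiff : ContMDiff 𝓘(ℝ, E') 𝓘(ℝ, E) ∞ i
  immersion : ∀ p, Function.Injective (mfderiv 𝓘(ℝ, E') 𝓘(ℝ, E) i p)
  /-- the rank of the radical distribution -/
  r : ℕ
  r_pos : 0 < r
  finrank_radical : ∀ p, Module.finrank ℝ (radical E' g i p) = r
  radical_smooth : IsSmoothSubbundle E' (radical E' g i)
  /-- the screen distribution `S(TM)`, a complement of `Rad TM` in `TM` -/
  screen : SubspaceField E i
  screen_smooth : IsSmoothSubbundle E' screen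
  radical_inf_screen : ∀ p, radical E' g i p ⊓ screen p = ⊥
  radical_sup_screen : ∀ p, radical E' g i p ⊔ screen p = tangent E' i p
  /-- the screen transversal bundle `S(TM^⊥)`, a complement of `Rad TM` in `TM^⊥` -/
  screenTr : SubspaceField E i
  screenTr_smooth : IsSmoothSubbundle E' screenTr
  radical_inf_screenTr : ∀ p, radical E' g i p ⊓ screenTr p = ⊥
  radical_sup_screenTr : ∀ p, radical E' g i p ⊔ screenTr p = perp g (tangent E' i) p
  /-- the lightlike transversal bundle `ltr(TM)`: a totally null complement of `Rad TM` in the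
  orthogonal complement of `S(TM) ⊥ S(TM^⊥)`. Equivalently, it has local frames `N₁, …, N_r` with
  `g(N_a, ξ_b) = δ_ab`, `g(N_a, N_b) = 0` for local frames `ξ₁, …, ξ_r` of `Rad TM`, and is
  orthogonal to `S(TM)` and `S(TM^⊥)`. -/
  ltr : SubspaceField E i
  ltr_smooth : IsSmoothSubbundle E' ltr
  ltr_null : ∀ p, ∀ u ∈ ltr p, ∀ v ∈ ltr p, g.val (i p) u v = 0
  radical_inf_ltr : ∀ p, radical E' g i p ⊓ ltr p = ⊥
  radical_sup_ltr : ∀ p, radical E' g i p ⊔ ltr p = perp g screen p ⊓ perp g screenTr p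

namespace LightlikeSubmanifold

variable {g : SemiRiemannianMetric E N} {i : M → N}

section Decomposition

variable [FiniteDimensional ℝ E] (L : LightlikeSubmanifold E' g i) (p : M)

theorem isCompl :
    IsCompl (tangent E' i p) (L.ltr p ⊔ L.screenTr p) ∧
    IsCompl (L.ltr p) (tangent E' i p ⊔ L.screenTr p) ∧
    IsCompl (L.screenTr p) (tangent E' i p ⊔ L.ltr p) := by
  have : FiniteDimensional ℝ (TangentSpace 𝓘(ℝ, E) (i p)) := inferInstanceAs (FiniteDimensional ℝ E)
  let B : LinearMap.BilinForm ℝ (TangentSpace 𝓘(ℝ, E) (i p)) :=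
    LinearMap.mk₂ ℝ (fun u v ↦ g.val (i p) u v) (by simp) (by simp) (by simp) (by simp)
  have hB : ∀ D : SubspaceField E i, perp g D p = B.orthogonal (D p) := fun D ↦ rfl
  exact isCompl_of_decomposition (lightlike_decomposition B (g.symm (i p)) (g.nondegenerate (i p))
    (R := radical E' g i p) (S := L.screen p) rfl (L.radical_inf_screen p) (L.radical_sup_screen p)
    (L.radical_inf_screenTr p) (L.radical_sup_screenTr p) (L.radical_inf_ltr p)
    (L.radical_sup_ltr p))

/-- The component in `TM` with respect to `TN|_M = TM ⊕ ltr(TM) ⊕ S(TM^⊥)`. -/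
def tanPart : TangentSpace 𝓘(ℝ, E) (i p) →ₗ[ℝ] TangentSpace 𝓘(ℝ, E) (i p) :=
  Submodule.projection _ _ (L.isCompl p).1

/-- The component in `ltr(TM)` with respect to `TN|_M = TM ⊕ ltr(TM) ⊕ S(TM^⊥)`. -/
def ltrPart : TangentSpace 𝓘(ℝ, E) (i p) →ₗ[ℝ] TangentSpace 𝓘(ℝ, E) (i p) :=
  Submodule.projection _ _ (L.isCompl p).2.1

/-- The component in `S(TM^⊥)` with respect to `TN|_M = TM ⊕ ltr(TM) ⊕ S(TM^⊥)`. -/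
def screenTrPart : TangentSpace 𝓘(ℝ, E) (i p) →ₗ[ℝ] TangentSpace 𝓘(ℝ, E) (i p) :=
  Submodule.projection _ _ (L.isCompl p).2.2

/-- `f V`, the tangential part of `J V`. -/
def f (J : EndField E N) (V : FieldAlong E i) : FieldAlong E i :=
  fun p ↦ L.tanPart p (J (i p) (V p))

/-- `w V`, the transversal part of `J V`, that is its component in
`tr(TM) = ltr(TM) ⊥ S(TM^⊥)`. -/
def w (J : EndField E N) (V : FieldAlong E i) : FieldAlong E i :=
  fun p ↦ L.ltrPart p (J (i p) (V p)) + L.screenTrPart p (J (i p) (V p))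

/-! The parts of the Gauss and Weingarten formulae of a connection `D` on `N`. Here `X` is a vector
field on `M`, `Y` one along `i` which is tangent to `M`, and `W` is a section of `S(TM^⊥)`:
`D_X Y = induced X Y + hl X Y + hs X Y` and `D_X W = - shape W X + screenConn X W + Dl X W`. -/

variable (D : AffineConnection E N) (X : (p : M) → TangentSpace 𝓘(ℝ, E') p)

/-- The connection induced on `M`. -/
def induced (Y : FieldAlong E i) : FieldAlong E i :=
  fun p ↦ L.tanPart p (covAlong D i Y p (X p))

/-- The lightlike second fundamental form `h^l(X, Y)`. -/
def hl (Y : FieldAlong E i) : FieldAlong E i :=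
  fun p ↦ L.ltrPart p (covAlong D i Y p (X p))

/-- The screen second fundamental form `h^s(X, Y)`. -/
def hs (Y : FieldAlong E i) : FieldAlong E i :=
  fun p ↦ L.screenTrPart p (covAlong D i Y p (X p))

/-- The shape operator `A_W X`. -/
def shape (W : FieldAlong E i) : FieldAlong E i :=
  fun p ↦ -L.tanPart p (covAlong D i W p (X p))

/-- The connection on `S(TM^⊥)`, denoted `D^s_X W` for a connection `D`. -/
def screenConn (W : FieldAlong E i) : FieldAlong E i :=
  fun p ↦ L.screenTrPart p (covAlong D i W p (X p))

/-- The `ltr(TM)`-valued part `D^l(X, W)` of the derivative of `W`. -/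
def Dl (W : FieldAlong E i) : FieldAlong E i :=
  fun p ↦ L.ltrPart p (covAlong D i W p (X p))

end Decomposition

/-- `B_o = J(S(TM)) ∩ S(TM)`. -/
def Bo (L : LightlikeSubmanifold E' g i) (J : EndField E N) : SubspaceField E i :=
  fun p ↦ (L.screen p).map (J (i p)).toLinearMap ⊓ L.screen p

/-- `B = B_o ⊥ Rad TM`. -/
def B (L : LightlikeSubmanifold E' g i) (J : EndField E N) : SubspaceField E i :=
  fun p ↦ L.Bo J p ⊔ radical E' g i p

end LightlikeSubmanifold

/-- `M` is a screen generic lightlike submanifold: `J(Rad TM) = Rad TM`, and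
`B_o = J(S(TM)) ∩ S(TM)` is a nondegenerate subbundle of `S(TM)`. The complementary nondegenerate
distribution `B'` in `S(TM)` is part of the data. Neither properness nor any compatibility of `J`
with `B'` is required (`J Z ∉ S(TM)` for nonzero `Z ∈ B'` is automatic, and so is
`w Z ∈ S(TM^⊥)`). -/
structure ScreenGeneric {g : SemiRiemannianMetric E N} {i : M → N}
    (L : LightlikeSubmanifold E' g i) (J : EndField E N) where
  map_radical : ∀ p, (radical E' g i p).map (J (i p)).toLinearMap = radical E' g i p
  Bo_smooth : IsSmoothSubbundle E' (L.Bo J)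
  Bo_nondegenerate : IsNondegenerate g (L.Bo J)
  /-- the distribution `B'` -/
  B' : SubspaceField E i
  B'_smooth : IsSmoothSubbundle E' B'
  B'_nondegenerate : IsNondegenerate g B'
  Bo_inf_B' : ∀ p, L.Bo J p ⊓ B' p = ⊥
  Bo_sup_B' : ∀ p, L.Bo J p ⊔ B' p = L.screen p

/-- `X ∈ Γ(B)` as a vector field on `M`: it is smooth and `di(X)` takes values in `B`. -/
def IsTangentSection {i : M → N} [IsManifold 𝓘(ℝ, E') ∞ M] (B : SubspaceField E i)
    (X : (p : M) → TangentSpace 𝓘(ℝ, E') p) : Prop :=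
  ContMDiff 𝓘(ℝ, E') 𝓘(ℝ, E').tangent ∞ (fun p ↦ (⟨p, X p⟩ : TangentBundle 𝓘(ℝ, E') M)) ∧
    ∀ p, push i X p ∈ B p

/-- `M` is mixed geodesic with respect to the connection `D`: both second fundamental forms
`h^l` and `h^s` vanish on `B × B'`. -/
def IsMixedGeodesic [FiniteDimensional ℝ E] [IsManifold 𝓘(ℝ, E') ∞ M]
    {g : SemiRiemannianMetric E N} {i : M → N} {L : LightlikeSubmanifold E' g i}
    {J : EndField E N} (G : ScreenGeneric L J) (D : AffineConnection E N) : Prop :=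
  ∀ (X : (p : M) → TangentSpace 𝓘(ℝ, E') p) (Z : FieldAlong E i),
    IsTangentSection (L.B J) X → IsSection E' G.B' Z →
      ∀ p, L.hl D X Z p = 0 ∧ L.hs D X Z p = 0

end Lightlike

end LightlikeBronze

end

open LightlikeBronze

/-! Let $a=\bar\Omega_XZ$ and $y=\bar\Omega_X(\bar JZ)=\bar\Omega_X fZ+\bar\Omega_X wZ$. Since $\bar
J$ is parallel for $\bar\nabla$ and $\bar J^2=3\bar J+I$, one gets $\bar Ja=y+c_1X+c_2\bar JX$,
where $c_1,c_2$ collect exactly the $\theta$-terms of (i) (`apply_covAlong_lmConnection`). The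
distribution $B$ is $\bar J$-invariant (`ScreenGeneric.apply_mem_B`), so $X$ and $\bar JX$ are
tangent to $M$, hence orthogonal to $\mathrm{Rad}(TM)$ and to $S(TM^\perp)$: the correction terms
are never seen.

The `ltr` component of a vector is detected by pairing with the radical, the `screenTr` component by
pairing with `screenTr`. As $\bar J$ is self-adjoint and maps the radical onto itself, $\bar
h^l(X,Z)=0$ exactly when $\bar g(y,\xi)=0$ for all $\xi$, which is (i).

For $\bar h^s$, invert $\bar J$ by $\bar J^{-1}=\bar J-3I$: then $\bar g(a,W)=\bar g(y,\bar
JW)-3\bar g(y,W)$. Splitting $y$ and $\bar JW$ into components turns the vanishing of the right side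
into (ii), but only once the `ltr` component of $y$ is known to vanish. So (i) is settled first and
then used in (ii) (`ScreenGeneric.screenTr_condition_iff`).

The analytic content is the calculus of $\bar\Omega$ on fields along $i$: additivity, which needs
$fZ$ and $wZ$ differentiable (`DiffAlongAt.projection`), and commutation with a parallel $\bar J$
(`covAlong_applyEnd`). Passing from sections to vectors of a fibre uses bump functions
(`IsSmoothSubbundle.exists_section`). -/

namespace LightlikeBronze

/-! ### Differential calculus of vector fields along an immersion. -/

section AlongCalculus

open Filter Topology

variable {E : Type*} [NormedAddCommGroup E] [NormedSpace ℝ E]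
  {N : Type*} [TopologicalSpace N] [ChartedSpace E N] [IsManifold 𝓘(ℝ, E) ∞ N]
  {E' : Type*} [NormedAddCommGroup E'] [NormedSpace ℝ E']
  {M : Type*} [TopologicalSpace M] [ChartedSpace E' M] {i : M → N} {p : M}

/-- A vector field along `i`, read in the preferred trivialization of `TN` at `i p`. -/
noncomputable def inTriv (i : M → N) (p : M) (V : FieldAlong E i) (q : M) : E :=
  (trivializationAt E (TangentSpace 𝓘(ℝ, E) : N → Type _) (i p)).continuousLinearMapAt ℝ
    (i q) (V q)

theorem eventually_mem_baseSet (hi : ContinuousAt i p) :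
    ∀ᶠ q in 𝓝 p, i q ∈ (trivializationAt E (TangentSpace 𝓘(ℝ, E) : N → Type _) (i p)).baseSet :=
  hi.eventually ((trivializationAt E (TangentSpace 𝓘(ℝ, E) : N → Type _) (i p)).open_baseSet.mem_nhds
    (FiberBundle.mem_baseSet_trivializationAt' (i p)))

/-- `continuousLinearMapAt` is zero off the base set, which makes `inTriv` linear in the field at
every point; the price is that it agrees with the trivialization itself only near `p`. -/
theorem inTriv_eventuallyEq (hi : ContinuousAt i p) (V : FieldAlong E i) :
    inTriv i p V =ᶠ[𝓝 p] fun q ↦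
      (trivializationAt E (TangentSpace 𝓘(ℝ, E) : N → Type _) (i p)
        (⟨i q, V q⟩ : TangentBundle 𝓘(ℝ, E) N)).2 := by
  filter_upwards [eventually_mem_baseSet (E := E) hi] with q hq
  simp only [inTriv]
  rw [Trivialization.continuousLinearMapAt_apply, Trivialization.linearMapAt_apply, if_pos hq]

theorem contMDiffAt_along_iff {n : ℕ∞ω} (hi : ContMDiffAt 𝓘(ℝ, E') 𝓘(ℝ, E) n i p)
    (V : FieldAlong E i) :
    ContMDiffAt 𝓘(ℝ, E') 𝓘(ℝ, E).tangent n
        (fun q ↦ (⟨i q, V q⟩ : TangentBundle 𝓘(ℝ, E) N)) p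
      ↔ ContMDiffAt 𝓘(ℝ, E') 𝓘(ℝ, E) n (inTriv i p V) p := by
  rw [(inTriv_eventuallyEq hi.continuousAt V).contMDiffAt_iff]
  refine (contMDiffAt_totalSpace (IB := 𝓘(ℝ, E)) (F := E)).trans ?_
  exact and_iff_right hi

theorem mdifferentiableAt_along_iff (hi : MDifferentiableAt 𝓘(ℝ, E') 𝓘(ℝ, E) i p)
    (V : FieldAlong E i) :
    MDifferentiableAt 𝓘(ℝ, E') 𝓘(ℝ, E).tangent
        (fun q ↦ (⟨i q, V q⟩ : TangentBundle 𝓘(ℝ, E) N)) p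
      ↔ MDifferentiableAt 𝓘(ℝ, E') 𝓘(ℝ, E) (inTriv i p V) p := by
  rw [(inTriv_eventuallyEq hi.continuousAt V).mdifferentiableAt_iff]
  refine (mdifferentiableAt_totalSpace (IB := 𝓘(ℝ, E)) (F := E) _).trans ?_
  exact and_iff_right hi

/-- Differentiability at `p` of a vector field along `i`. -/
def DiffAlongAt (E' : Type*) [NormedAddCommGroup E'] [NormedSpace ℝ E'] [ChartedSpace E' M]
    (V : FieldAlong E i) (p : M) : Prop :=
  MDifferentiableAt 𝓘(ℝ, E') 𝓘(ℝ, E) (inTriv i p V) p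

omit [TopologicalSpace M] in
theorem inTriv_add (U V : FieldAlong E i) : inTriv i p (U + V) = inTriv i p U + inTriv i p V := by
  ext q; simp [inTriv]

omit [TopologicalSpace M] in
theorem inTriv_smul (c : M → ℝ) (V : FieldAlong E i) :
    inTriv i p (fun q ↦ c q • V q) = c • inTriv i p V := by
  ext q; simp [inTriv]

theorem SmoothAlongOn.contMDiffAt {V : FieldAlong E i} {U : Set M} (h : SmoothAlongOn E' i V U)
    (hU : U ∈ 𝓝 p) (hi : ContMDiff 𝓘(ℝ, E') 𝓘(ℝ, E) ∞ i) :
    ContMDiffAt 𝓘(ℝ, E') 𝓘(ℝ, E) ∞ (inTriv i p V) p :=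
  (contMDiffAt_along_iff hi.contMDiffAt V).1 (ContMDiffOn.contMDiffAt h hU)

theorem SmoothAlongOn.diffAlongAt {V : FieldAlong E i} {U : Set M} (h : SmoothAlongOn E' i V U)
    (hU : U ∈ 𝓝 p) (hi : ContMDiff 𝓘(ℝ, E') 𝓘(ℝ, E) ∞ i) : DiffAlongAt E' V p :=
  (h.contMDiffAt hU hi).mdifferentiableAt (by simp)

theorem IsSection.diffAlongAt {D : SubspaceField E i} {V : FieldAlong E i} (h : IsSection E' D V)
    (hi : ContMDiff 𝓘(ℝ, E') 𝓘(ℝ, E) ∞ i) (p : M) : DiffAlongAt E' V p :=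
  h.1.diffAlongAt Filter.univ_mem hi

theorem DiffAlongAt.add {U V : FieldAlong E i} (hU : DiffAlongAt E' U p)
    (hV : DiffAlongAt E' V p) : DiffAlongAt E' (U + V) p := by
  unfold DiffAlongAt
  rw [inTriv_add]
  exact MDifferentiableAt.add hU hV

theorem DiffAlongAt.smul {c : M → ℝ} {V : FieldAlong E i}
    (hc : MDifferentiableAt 𝓘(ℝ, E') 𝓘(ℝ, ℝ) c p) (hV : DiffAlongAt E' V p) :
    DiffAlongAt E' (fun q ↦ c q • V q) p := by
  unfold DiffAlongAt
  rw [inTriv_smul]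
  exact MDifferentiableAt.smul hc hV

theorem DiffAlongAt.sub {U V : FieldAlong E i} (hU : DiffAlongAt E' U p)
    (hV : DiffAlongAt E' V p) : DiffAlongAt E' (U - V) p := by
  have : U - V = U + fun q ↦ (-1 : ℝ) • V q := by
    ext q; simp [sub_eq_add_neg]
  rw [this]
  exact hU.add (DiffAlongAt.smul mdifferentiableAt_const hV)

theorem DiffAlongAt.congr {U V : FieldAlong E i} (hU : DiffAlongAt E' U p)
    (h : ∀ᶠ q in 𝓝 p, V q = U q) :
    DiffAlongAt E' V p := by
  refine MDifferentiableAt.congr_of_eventuallyEq hU ?_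
  filter_upwards [h] with q hq
  simp [inTriv, hq]

theorem DiffAlongAt.sum {ι : Type*} (t : Finset ι) {c : ι → M → ℝ} {s : ι → FieldAlong E i}
    (hc : ∀ a, MDifferentiableAt 𝓘(ℝ, E') 𝓘(ℝ, ℝ) (c a) p) (hs : ∀ a, DiffAlongAt E' (s a) p) :
    DiffAlongAt E' (fun q ↦ ∑ a ∈ t, c a q • s a q) p := by
  classical
  induction t using Finset.induction_on with
  | empty =>
    refine (mdifferentiableAt_const (c := (0 : E))).congr_of_eventuallyEq (.of_forall fun q ↦ ?_)
    simp [inTriv]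
  | insert a t ha ih =>
    simp only [Finset.sum_insert ha]
    exact (DiffAlongAt.smul (hc a) (hs a)).add ih

theorem DiffAlongAt.comp {Y : (x : N) → TangentSpace 𝓘(ℝ, E) x}
    (hi : MDifferentiableAt 𝓘(ℝ, E') 𝓘(ℝ, E) i p) (hY : MDiffAt (T% Y) (i p)) :
    DiffAlongAt E' (fun q ↦ Y (i q)) p :=
  (mdifferentiableAt_along_iff hi _).1 (hY.comp p hi)

theorem DiffAlongAt.applyEnd {J : EndField E N} {V : FieldAlong E i}
    (hi : MDifferentiableAt 𝓘(ℝ, E') 𝓘(ℝ, E) i p)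
    (hJ : ContMDiff 𝓘(ℝ, E) (𝓘(ℝ, E).prod 𝓘(ℝ, E →L[ℝ] E)) ∞
      (fun x ↦ TotalSpace.mk' (E →L[ℝ] E) x (J x)))
    (hV : DiffAlongAt E' V p) : DiffAlongAt E' (applyEnd J V) p := by
  refine (mdifferentiableAt_along_iff hi _).1 ?_
  have h1 := ((hJ (i p)).mdifferentiableAt (by simp)).comp p hi
  exact MDifferentiableAt.clm_bundle_apply (𝕜 := ℝ) (F₁ := E) (F₂ := E)
    (E₁ := (TangentSpace 𝓘(ℝ, E) : N → Type _)) (E₂ := (TangentSpace 𝓘(ℝ, E) : N → Type _))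
    h1 ((mdifferentiableAt_along_iff hi V).2 hV)

variable [FiniteDimensional ℝ E]

/-- A frame coefficient depends only on the value at the point, so any extension of `v` to a section
computes it. This makes the coefficients linear functions of `inTriv`, and hence differentiable
along with it. -/
theorem localFrameCoeff_eq_repr {y : N} {e : Trivialization E (π E (TangentSpace 𝓘(ℝ, E) : N → Type _))}
    [MemTrivializationAtlas e] (hy : y ∈ e.baseSet) (a : Fin (Module.finrank ℝ E))
    (v : TangentSpace 𝓘(ℝ, E) y) :
    e.localFrameCoeff 𝓘(ℝ, E) (Module.finBasis ℝ E) a y v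
      = (Module.finBasis ℝ E).repr (e.continuousLinearMapAt ℝ y v) a := by
  have h := e.localFrameCoeff_eq_coeff (I := 𝓘(ℝ, E)) (b := Module.finBasis ℝ E)
    (s := FiberBundle.extend E v) hy (i := a)
  dsimp only at h
  rw [FiberBundle.extend_apply_self] at h
  rw [h, Trivialization.continuousLinearMapAt_apply, Trivialization.linearMapAt_apply, if_pos hy]

/-- The coefficients of a vector field along `i` in the coordinate frame at `i p`. -/
noncomputable def alongCoeff (i : M → N) (p : M) (a : Fin (Module.finrank ℝ E)) (V : FieldAlong E i) (q : M) : ℝ :=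
  (trivializationAt E (TangentSpace 𝓘(ℝ, E) : N → Type _) (i p)).localFrameCoeff 𝓘(ℝ, E)
    (Module.finBasis ℝ E) a (i q) (V q)

theorem DiffAlongAt.alongCoeff {V : FieldAlong E i} (hi : ContinuousAt i p)
    (hV : DiffAlongAt E' V p) (a : Fin (Module.finrank ℝ E)) :
    MDifferentiableAt 𝓘(ℝ, E') 𝓘(ℝ, ℝ) (alongCoeff i p a V) p := by
  let φ : E →L[ℝ] ℝ := LinearMap.toContinuousLinearMap ((Module.finBasis ℝ E).coord a)
  have h : MDifferentiableAt 𝓘(ℝ, E') 𝓘(ℝ, ℝ) (φ ∘ inTriv i p V) p :=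
    φ.mdifferentiableAt.comp p hV
  refine h.congr_of_eventuallyEq ?_
  filter_upwards [eventually_mem_baseSet (E := E) hi] with q hq
  exact localFrameCoeff_eq_repr hq a (V q)

theorem eventually_eq_sum_alongCoeff (hi : ContinuousAt i p) (V : FieldAlong E i) :
    ∀ᶠ q in 𝓝 p, V q = ∑ a, alongCoeff i p a V q •
      (trivializationAt E (TangentSpace 𝓘(ℝ, E) : N → Type _) (i p)).localFrame
        (Module.finBasis ℝ E) a (i q) := by
  filter_upwards [eventually_mem_baseSet (E := E) hi] with q hq
  have h := (trivializationAt E (TangentSpace 𝓘(ℝ, E) : N → Type _) (i p)).eq_sum_localFrameCoeff_smul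
    (I := 𝓘(ℝ, E)) (b := Module.finBasis ℝ E) (s := FiberBundle.extend E (V q)) hq
  rw [FiberBundle.extend_apply_self] at h
  exact h

theorem covAlong_eq (cov : AffineConnection E N) (V : FieldAlong E i) (v : TangentSpace 𝓘(ℝ, E') p) :
    covAlong cov i V p v = ∑ a, (mvfderiv 𝓘(ℝ, E') (alongCoeff i p a V) p v
      • (trivializationAt E (TangentSpace 𝓘(ℝ, E) : N → Type _) (i p)).localFrame
          (Module.finBasis ℝ E) a (i p)
      + alongCoeff i p a V p
        • cov ((trivializationAt E (TangentSpace 𝓘(ℝ, E) : N → Type _) (i p)).localFrame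
          (Module.finBasis ℝ E) a) (i p) (mfderiv 𝓘(ℝ, E') 𝓘(ℝ, E) i p v)) :=
  rfl

theorem covAlong_congr (cov : AffineConnection E N) {U V : FieldAlong E i}
    (h : ∀ᶠ q in 𝓝 p, U q = V q)
    (v : TangentSpace 𝓘(ℝ, E') p) : covAlong cov i U p v = covAlong cov i V p v := by
  have h' : ∀ a, alongCoeff i p a U =ᶠ[𝓝 p] alongCoeff i p a V := fun a ↦ by
    filter_upwards [h] with q hq
    simp [alongCoeff, hq]
  have hd : ∀ a, mvfderiv 𝓘(ℝ, E') (alongCoeff i p a U) p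
      = mvfderiv 𝓘(ℝ, E') (alongCoeff i p a V) p := fun a ↦ by
    simp only [mvfderiv, (h' a).mfderiv_eq]
    rfl
  simp only [covAlong_eq, hd, (h' _).eq_of_nhds]

theorem covAlong_add (cov : AffineConnection E N) {U V : FieldAlong E i} (hi : ContinuousAt i p)
    (hU : DiffAlongAt E' U p) (hV : DiffAlongAt E' V p) (v : TangentSpace 𝓘(ℝ, E') p) :
    covAlong cov i (U + V) p v = covAlong cov i U p v + covAlong cov i V p v := by
  have h : ∀ a, alongCoeff i p a (U + V) = alongCoeff i p a U + alongCoeff i p a V := fun a ↦ by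
    ext q; simp [alongCoeff]
  simp only [covAlong_eq, ← Finset.sum_add_distrib, h]
  refine Finset.sum_congr rfl fun a _ ↦ ?_
  rw [mvfderiv_add (hU.alongCoeff hi a) (hV.alongCoeff hi a)]
  simp only [Pi.add_apply, add_apply]
  module

theorem covAlong_smul (cov : AffineConnection E N) {c : M → ℝ} {V : FieldAlong E i}
    (hi : ContinuousAt i p) (hc : MDifferentiableAt 𝓘(ℝ, E') 𝓘(ℝ, ℝ) c p)
    (hV : DiffAlongAt E' V p) (v : TangentSpace 𝓘(ℝ, E') p) :
    covAlong cov i (fun q ↦ c q • V q) p v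
      = mvfderiv 𝓘(ℝ, E') c p v • V p + c p • covAlong cov i V p v := by
  have h : ∀ a, alongCoeff i p a (fun q ↦ c q • V q) = c • alongCoeff i p a V := fun a ↦ by
    ext q; simp [alongCoeff]
  rw [covAlong_eq, covAlong_eq]
  -- The undifferentiated `V p` is expanded in the frame so that both sides can be compared term by
  -- term.
  conv_rhs => lhs; rw [(eventually_eq_sum_alongCoeff hi V).self_of_nhds]
  simp only [h]
  rw [Finset.smul_sum, Finset.smul_sum, ← Finset.sum_add_distrib]
  refine Finset.sum_congr rfl fun a _ ↦ ?_
  rw [mvfderiv_smul hc (hV.alongCoeff hi a)]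
  simp only [Pi.smul_apply', add_apply, smul_apply, ContinuousLinearMap.smulRight_apply,
    smul_eq_mul]
  module

theorem covAlong_zero (cov : AffineConnection E N) (v : TangentSpace 𝓘(ℝ, E') p) :
    covAlong cov i 0 p v = 0 := by
  have h : ∀ a, alongCoeff i p a (0 : FieldAlong E i) = 0 := fun a ↦ by
    ext q; simp [alongCoeff]
  simp only [covAlong_eq, h, mvfderiv_zero]
  simp

theorem covAlong_sum (cov : AffineConnection E N) {ι : Type*} (t : Finset ι) {c : ι → M → ℝ}
    {s : ι → FieldAlong E i} (hi : ContinuousAt i p)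
    (hc : ∀ a, MDifferentiableAt 𝓘(ℝ, E') 𝓘(ℝ, ℝ) (c a) p) (hs : ∀ a, DiffAlongAt E' (s a) p)
    (v : TangentSpace 𝓘(ℝ, E') p) :
    covAlong cov i (fun q ↦ ∑ a ∈ t, c a q • s a q) p v
      = ∑ a ∈ t, (mvfderiv 𝓘(ℝ, E') (c a) p v • s a p + c a p • covAlong cov i (s a) p v) := by
  classical
  induction t using Finset.induction_on with
  | empty => exact covAlong_zero cov v
  | insert a t ha ih =>
    simp only [Finset.sum_insert ha]
    rw [← ih, ← covAlong_smul cov hi (hc a) (hs a)]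
    exact covAlong_add cov hi (DiffAlongAt.smul (hc a) (hs a)) (DiffAlongAt.sum t hc hs) v

/-- A parallel endomorphism field commutes with the connection pulled back along `i`. -/
theorem covAlong_applyEnd (cov : AffineConnection E N) {J : EndField E N} {V : FieldAlong E i}
    (hi : MDifferentiableAt 𝓘(ℝ, E') 𝓘(ℝ, E) i p)
    (hJ : ContMDiff 𝓘(ℝ, E) (𝓘(ℝ, E).prod 𝓘(ℝ, E →L[ℝ] E)) ∞
      (fun x ↦ TotalSpace.mk' (E →L[ℝ] E) x (J x)))
    (hpar : ∀ (x : N) (Y : (x : N) → TangentSpace 𝓘(ℝ, E) x), MDiffAt (T% Y) x →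
      ∀ v : TangentSpace 𝓘(ℝ, E) x, cov (fun y ↦ J y (Y y)) x v = J x (cov Y x v))
    (hV : DiffAlongAt E' V p) (v : TangentSpace 𝓘(ℝ, E') p) :
    covAlong cov i (applyEnd J V) p v = J (i p) (covAlong cov i V p v) := by
  let e := trivializationAt E (TangentSpace 𝓘(ℝ, E) : N → Type _) (i p)
  let b := Module.finBasis ℝ E
  have hs : ∀ a, MDiffAt (T% (e.localFrame b a)) (i p) := fun a ↦
    (contMDiffAt_localFrame_of_mem (I := 𝓘(ℝ, E)) 1 e b a
      (FiberBundle.mem_baseSet_trivializationAt' (i p))).mdifferentiableAt (by simp)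
  have hJs : ∀ a, MDiffAt (T% (fun y ↦ J y (e.localFrame b a y))) (i p) := fun a ↦
    MDifferentiableAt.clm_bundle_apply (𝕜 := ℝ) (F₁ := E) (F₂ := E)
      (E₁ := (TangentSpace 𝓘(ℝ, E) : N → Type _)) (E₂ := (TangentSpace 𝓘(ℝ, E) : N → Type _))
      ((hJ (i p)).mdifferentiableAt (by simp)) (hs a)
  have hc := fun a ↦ hV.alongCoeff hi.continuousAt a
  have hVs := eventually_eq_sum_alongCoeff hi.continuousAt V
  -- The same coefficients serve for $V$ in the frame $e_a$ and for $JV$ in the fields $Je_a$. Their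
  -- derivatives therefore match, and only parallelism on the ambient fields $e_a$ remains.
  have hJV : ∀ᶠ q in 𝓝 p, applyEnd J V q = ∑ a, alongCoeff i p a V q •
      J (i q) (e.localFrame b a (i q)) := by
    filter_upwards [hVs] with q hq
    simp only [applyEnd]
    conv_lhs => rw [hq]
    simp [e, b]
  rw [covAlong_congr cov hJV, covAlong_congr cov hVs,
    covAlong_sum cov Finset.univ hi.continuousAt hc fun a ↦ DiffAlongAt.comp hi (hJs a),
    covAlong_sum cov Finset.univ hi.continuousAt hc fun a ↦ DiffAlongAt.comp hi (hs a), map_sum]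
  refine Finset.sum_congr rfl fun a _ ↦ ?_
  rw [covAlong_comp cov i p hi _ (hJs a), covAlong_comp cov i p hi _ (hs a), hpar _ _ (hs a)]
  simp [e, b]

/-- The two connections differ by a tensor, so the derivatives of the coefficients cancel and `V`
need not be differentiable. -/
theorem covAlong_lmConnection (g : SemiRiemannianMetric E N) (J : EndField E N)
    (cov : AffineConnection E N) (l m : N → ℝ) (η : (x : N) → TangentSpace 𝓘(ℝ, E) x)
    (hi : ContinuousAt i p) (V : FieldAlong E i) (v : TangentSpace 𝓘(ℝ, E') p) :
    covAlong (lmConnection g J cov l m η) i V p v = covAlong cov i V p v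
      + theta g η (i p) (V p) • (l (i p) • mfderiv 𝓘(ℝ, E') 𝓘(ℝ, E) i p v
        + m (i p) • J (i p) (mfderiv 𝓘(ℝ, E') 𝓘(ℝ, E) i p v)) := by
  rw [covAlong_eq, covAlong_eq]
  conv_rhs => rhs; rw [(eventually_eq_sum_alongCoeff hi V).self_of_nhds]
  simp only [lmConnection_apply]
  rw [map_sum, Finset.sum_smul, ← Finset.sum_add_distrib]
  refine Finset.sum_congr rfl fun a _ ↦ ?_
  rw [map_smul, smul_eq_mul]
  module

end AlongCalculus

end LightlikeBronze

namespace LightlikeBronze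

/-! ### Smooth subbundles: frames, projections and global sections. -/

section Subbundles

open Filter Topology

variable {E : Type*} [NormedAddCommGroup E] [NormedSpace ℝ E]
  {N : Type*} [TopologicalSpace N] [ChartedSpace E N] [IsManifold 𝓘(ℝ, E) ∞ N]
  {E' : Type*} [NormedAddCommGroup E'] [NormedSpace ℝ E']
  {M : Type*} [TopologicalSpace M] [ChartedSpace E' M] {i : M → N} {p : M}

theorem span_range_sumElim {R V ι κ : Type*} [Semiring R] [AddCommMonoid V] [Module R V]
    (s : ι → V) (t : κ → V) : Submodule.span R (Set.range (Sum.elim s t))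
      = Submodule.span R (Set.range s) ⊔ Submodule.span R (Set.range t) := by
  rw [Set.Sum.elim_range, Submodule.span_union]

/-- The sum of two smooth subbundles which meet trivially is a smooth subbundle. -/
theorem IsSmoothSubbundle.sup {D₁ D₂ : SubspaceField E i} (h₁ : IsSmoothSubbundle E' D₁)
    (h₂ : IsSmoothSubbundle E' D₂) (hd : ∀ q, Disjoint (D₁ q) (D₂ q)) :
    IsSmoothSubbundle E' (fun q ↦ D₁ q ⊔ D₂ q) := by
  intro p
  obtain ⟨U₁, hU₁, k₁, s₁, hs₁, hb₁⟩ := h₁ p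
  obtain ⟨U₂, hU₂, k₂, s₂, hs₂, hb₂⟩ := h₂ p
  refine ⟨U₁ ∩ U₂, inter_mem hU₁ hU₂, k₁ + k₂,
    fun a q ↦ Sum.elim (fun b ↦ s₁ b q) (fun b ↦ s₂ b q) (finSumFinEquiv.symm a), fun a ↦ ?_,
    fun q hq ↦ ⟨?_, ?_⟩⟩
  · rcases h : finSumFinEquiv.symm a with b | b
    · simpa only [h] using! (hs₁ b).mono Set.inter_subset_left
    · simpa only [h] using! (hs₂ b).mono Set.inter_subset_right
  · refine LinearIndependent.comp ?_ _ finSumFinEquiv.symm.injective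
    refine (hb₁ q hq.1).1.sum_type (hb₂ q hq.2).1 ?_
    rw [(hb₁ q hq.1).2, (hb₂ q hq.2).2]
    exact hd q
  · have := finSumFinEquiv.symm.surjective.range_comp
      (Sum.elim (fun b ↦ s₁ b q) (fun b ↦ s₂ b q))
    rw [Function.comp_def] at this
    rw [this, span_range_sumElim, (hb₁ q hq.1).2, (hb₂ q hq.2).2]

/-- The coefficients of a differentiable field in a differentiable local frame are
differentiable. -/
theorem DiffAlongAt.exists_coeff [FiniteDimensional ℝ E] {ι : Type} [Fintype ι]
    {s : ι → FieldAlong E i}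
    (hi : ContinuousAt i p) (hs : ∀ a, DiffAlongAt E' (s a) p)
    (hb : ∀ᶠ q in 𝓝 p, LinearIndependent ℝ (fun a ↦ s a q) ∧
      Submodule.span ℝ (Set.range fun a ↦ s a q) = ⊤)
    {V : FieldAlong E i} (hV : DiffAlongAt E' V p) :
    ∃ c : ι → M → ℝ, (∀ a, MDifferentiableAt 𝓘(ℝ, E') 𝓘(ℝ, ℝ) (c a) p) ∧
      ∀ᶠ q in 𝓝 p, V q = ∑ a, c a q • s a q := by
  classical
  let e := trivializationAt E (TangentSpace 𝓘(ℝ, E) : N → Type _) (i p)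
  -- Read in the trivialization, the frame becomes an operator-valued function `F` sending
  -- coefficients to the vector they represent. It is invertible near `p`, and inversion of
  -- operators is differentiable there, so $F^{-1}V$ gives differentiable coefficients.
  let Φ : ι → E →L[ℝ] ((ι → ℝ) →L[ℝ] E) := fun a ↦
    ContinuousLinearMap.smulRightL ℝ (ι → ℝ) E (ContinuousLinearMap.proj a)
  let F : M → ((ι → ℝ) →L[ℝ] E) := ∑ a, fun q ↦ Φ a (inTriv i p (s a) q)
  have hF : ∀ q c, F q c = inTriv i p (fun q ↦ ∑ a, c a • s a q) q := fun q c ↦ by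
    simp [F, Φ, inTriv]
  have hFd : MDifferentiableAt 𝓘(ℝ, E') 𝓘(ℝ, (ι → ℝ) →L[ℝ] E) F p :=
    MDifferentiableAt.sum fun a _ ↦ (Φ a).mdifferentiableAt.comp p (hs a)
  have he : ∀ q (hq : i q ∈ e.baseSet) (v : TangentSpace 𝓘(ℝ, E) (i q)),
      e.continuousLinearEquivAt ℝ (i q) hq v = e.continuousLinearMapAt ℝ (i q) v := fun q hq v ↦ by
    rw [Trivialization.continuousLinearMapAt_apply, Trivialization.linearMapAt_apply, if_pos hq]
    rfl
  have hinv : ∀ᶠ q in 𝓝 p, (F q).IsInvertible := by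
    filter_upwards [hb, eventually_mem_baseSet (E := E) hi] with q hq hq'
    let β := Module.Basis.mk hq.1 hq.2.ge
    have : FiniteDimensional ℝ (TangentSpace 𝓘(ℝ, E) (i q)) :=
      inferInstanceAs (FiniteDimensional ℝ E)
    have : T2Space (TangentSpace 𝓘(ℝ, E) (i q)) := inferInstanceAs (T2Space E)
    refine ⟨β.equivFun.symm.toContinuousLinearEquiv.trans (e.continuousLinearEquivAt ℝ (i q) hq'),
      ContinuousLinearMap.ext fun c ↦ ?_⟩
    rw [hF]
    simp only [inTriv]
    have h1 : β.equivFun.symm c = ∑ a, c a • s a q := by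
      rw [Module.Basis.equivFun_symm_apply]
      simp [β]
    rw [← h1]
    exact he q hq' _
  have hc : MDifferentiableAt 𝓘(ℝ, E') 𝓘(ℝ, ι → ℝ)
      (fun q ↦ (F q).inverse (inTriv i p V q)) p := by
    have h1 : MDifferentiableAt 𝓘(ℝ, E') 𝓘(ℝ, E →L[ℝ] (ι → ℝ))
        (ContinuousLinearMap.inverse ∘ F) p :=
      ((hinv.self_of_nhds.contDiffAt_map_inverse (n := 1)).differentiableAt
        (by simp)).mdifferentiableAt.comp p hFd
    exact h1.clm_apply hV
  refine ⟨fun a q ↦ (F q).inverse (inTriv i p V q) a,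
    fun a ↦ (ContinuousLinearMap.proj (R := ℝ) (φ := fun _ : ι ↦ ℝ) a).mdifferentiableAt.comp p hc,
    ?_⟩
  filter_upwards [hinv, eventually_mem_baseSet (E := E) hi] with q hq hq'
  have h1 : F q ((F q).inverse (inTriv i p V q)) = inTriv i p V q := hq.self_apply_inverse _
  rw [hF] at h1
  exact (e.continuousLinearEquivAt ℝ (i q) hq').injective
    ((he q hq' _).trans (h1.symm.trans (he q hq' _).symm))

/-- The projection onto a smooth subbundle along a smooth complement preserves differentiability. -/
theorem DiffAlongAt.projection [FiniteDimensional ℝ E] {D₁ D₂ : SubspaceField E i}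
    (h₁ : IsSmoothSubbundle E' D₁)
    (h₂ : IsSmoothSubbundle E' D₂) (hc : ∀ q, IsCompl (D₁ q) (D₂ q))
    (hi : ContMDiff 𝓘(ℝ, E') 𝓘(ℝ, E) ∞ i) {V : FieldAlong E i} (hV : DiffAlongAt E' V p) :
    DiffAlongAt E' (i := i) (fun q ↦ Submodule.projection _ _ (hc q) (V q)) p := by
  obtain ⟨U₁, hU₁, k₁, s₁, hs₁, hb₁⟩ := h₁ p
  obtain ⟨U₂, hU₂, k₂, s₂, hs₂, hb₂⟩ := h₂ p
  obtain ⟨c, hcd, hcV⟩ := DiffAlongAt.exists_coeff (s := Sum.elim s₁ s₂)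
    (hi p).continuousAt
    (by
      rintro (a | a)
      · exact (hs₁ a).diffAlongAt hU₁ hi
      · exact (hs₂ a).diffAlongAt hU₂ hi)
    (by
      filter_upwards [hU₁, hU₂] with q hq₁ hq₂
      have : (fun a ↦ Sum.elim s₁ s₂ a q) = Sum.elim (fun b ↦ s₁ b q) (fun b ↦ s₂ b q) := by
        ext a; rcases a with a | a <;> rfl
      rw [this, span_range_sumElim, (hb₁ q hq₁).2, (hb₂ q hq₂).2]
      refine ⟨(hb₁ q hq₁).1.sum_type (hb₂ q hq₂).1 ?_, (hc q).sup_eq_top⟩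
      rw [(hb₁ q hq₁).2, (hb₂ q hq₂).2]
      exact (hc q).disjoint) hV
  -- In the frame joining those of `D₁` and `D₂`, the projection keeps the `D₁` terms and drops the
  -- others.
  refine (DiffAlongAt.sum Finset.univ (fun a ↦ hcd (Sum.inl a))
    fun a ↦ (hs₁ a).diffAlongAt hU₁ hi).congr ?_
  filter_upwards [hcV, hU₁, hU₂] with q hq hq₁ hq₂
  have m₁ : ∀ a, Submodule.projection _ _ (hc q) (s₁ a q) = s₁ a q := fun a ↦
    Submodule.projection_apply_of_mem_left (hc q)
      ((hb₁ q hq₁).2 ▸ Submodule.subset_span (Set.mem_range_self a))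
  have m₂ : ∀ a, Submodule.projection _ _ (hc q) (s₂ a q) = 0 := fun a ↦
    Submodule.projection_apply_of_mem_right (hc q)
      ((hb₂ q hq₂).2 ▸ Submodule.subset_span (Set.mem_range_self a))
  rw [hq, map_sum, Fintype.sum_sum_type]
  simp [m₁, m₂]

/-- Every vector in a fibre of a smooth subbundle is the value of a global smooth section. -/
theorem IsSmoothSubbundle.exists_section [FiniteDimensional ℝ E'] [T2Space M]
    [IsManifold 𝓘(ℝ, E') ∞ M] {D : SubspaceField E i} (hD : IsSmoothSubbundle E' D)
    (hi : ContMDiff 𝓘(ℝ, E') 𝓘(ℝ, E) ∞ i) {v : TangentSpace 𝓘(ℝ, E) (i p)} (hv : v ∈ D p) :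
    ∃ V : FieldAlong E i, IsSection E' D V ∧ V p = v := by
  obtain ⟨U, hU, k, s, hs, hb⟩ := hD p
  -- A bump function equal to 1 at `p` whose closed support lies in the interior of `U`; it cuts off
  -- the constant-coefficient combination of the frame. Near a point outside the closed support the
  -- product is zero.
  obtain ⟨χ, hχ, -⟩ := (SmoothBumpFunction.nhds_basis_support (I := 𝓘(ℝ, E'))
    (interior_mem_nhds.2 hU)).mem_iff.1 (interior_mem_nhds.2 hU)
  rw [← (hb p (mem_of_mem_nhds hU)).2, Submodule.mem_span_range_iff_exists_fun] at hv
  obtain ⟨c, rfl⟩ := hv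
  refine ⟨fun q ↦ χ q • ∑ a, c a • s a q, ⟨?_, fun q ↦ ?_⟩, by simp⟩
  · refine contMDiffOn_univ.2 fun q ↦ (contMDiffAt_along_iff (hi q) _).2 ?_
    rw [inTriv_smul]
    by_cases hq : q ∈ tsupport χ
    · have hqU : U ∈ 𝓝 q := mem_interior_iff_mem_nhds.1 (hχ hq)
      refine χ.contMDiff.contMDiffAt.smul ?_
      have : inTriv i q (fun q ↦ ∑ a, c a • s a q) = fun q' ↦ ∑ a, c a • inTriv i q (s a) q' := by
        ext q'; simp [inTriv]
      rw [this]
      refine contMDiffAt_finsetSum fun a _ ↦ ?_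
      have hc : ContMDiffAt 𝓘(ℝ, E') 𝓘(ℝ, ℝ) ∞ (fun _ : M ↦ c a) q := contMDiffAt_const
      exact hc.smul ((hs a).contMDiffAt hqU hi)
    · refine (contMDiffAt_const (c := (0 : E))).congr_of_eventuallyEq ?_
      filter_upwards [notMem_tsupport_iff_eventuallyEq.1 hq] with q' hq'
      simp [hq']
  · by_cases hq : q ∈ tsupport χ
    · rw [← (hb q (interior_subset (hχ hq))).2]
      exact Submodule.smul_mem _ _ (Submodule.sum_mem _ fun a _ ↦ Submodule.smul_mem _ _
        (Submodule.subset_span (Set.mem_range_self a)))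
    · simp [image_eq_zero_of_notMem_tsupport hq]

end Subbundles

end LightlikeBronze

namespace LightlikeBronze

/-! ### Orthogonality and components on a lightlike submanifold. -/

section Lightlike

variable {E : Type*} [NormedAddCommGroup E] [NormedSpace ℝ E]
  {N : Type*} [TopologicalSpace N] [ChartedSpace E N] [IsManifold 𝓘(ℝ, E) ∞ N]
  {E' : Type*} [NormedAddCommGroup E'] [NormedSpace ℝ E']
  {M : Type*} [TopologicalSpace M] [ChartedSpace E' M]
  {g : SemiRiemannianMetric E N} {i : M → N} {p : M}

namespace LightlikeSubmanifold

section Orthogonality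

variable (L : LightlikeSubmanifold E' g i)
  {u v : TangentSpace 𝓘(ℝ, E) (i p)}

theorem val_radical (hu : u ∈ tangent E' i p) (hv : v ∈ radical E' g i p) :
    g.val (i p) u v = 0 :=
  hv.2 u hu

theorem val_tangent_screenTr (hu : u ∈ tangent E' i p) (hv : v ∈ L.screenTr p) :
    g.val (i p) u v = 0 :=
  (L.radical_sup_screenTr p ▸ Submodule.mem_sup_right hv : v ∈ perp g (tangent E' i) p) u hu

theorem val_screenTr_ltr (hu : u ∈ L.screenTr p) (hv : v ∈ L.ltr p) : g.val (i p) u v = 0 :=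
  (L.radical_sup_ltr p ▸ Submodule.mem_sup_right hv : v ∈ perp g L.screen p ⊓ perp g L.screenTr p).2
    u hu

theorem val_screen_ltr (hu : u ∈ L.screen p) (hv : v ∈ L.ltr p) : g.val (i p) u v = 0 :=
  (L.radical_sup_ltr p ▸ Submodule.mem_sup_right hv : v ∈ perp g L.screen p ⊓ perp g L.screenTr p).1
    u hu

theorem screen_le_tangent : L.screen p ≤ tangent E' i p :=
  L.radical_sup_screen p ▸ le_sup_right

theorem B_le_tangent (J : EndField E N) : L.B J p ≤ tangent E' i p :=
  sup_le (inf_le_right.trans L.screen_le_tangent) inf_le_left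

variable [FiniteDimensional ℝ E]

theorem tanPart_mem (v : TangentSpace 𝓘(ℝ, E) (i p)) : L.tanPart p v ∈ tangent E' i p :=
  Submodule.projection_apply_mem _ v

theorem ltrPart_mem (v : TangentSpace 𝓘(ℝ, E) (i p)) : L.ltrPart p v ∈ L.ltr p :=
  Submodule.projection_apply_mem _ v

theorem screenTrPart_mem (v : TangentSpace 𝓘(ℝ, E) (i p)) : L.screenTrPart p v ∈ L.screenTr p :=
  Submodule.projection_apply_mem _ v

theorem parts_add (v : TangentSpace 𝓘(ℝ, E) (i p)) :
    L.tanPart p v + (L.ltrPart p v + L.screenTrPart p v) = v := by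
  obtain ⟨h₁, h₂, h₃⟩ := L.isCompl p
  obtain ⟨t, ht, u, hu, rfl⟩ := Submodule.mem_sup.1 (h₁.sup_eq_top ▸ Submodule.mem_top (x := v))
  obtain ⟨n, hn, w, hw, rfl⟩ := Submodule.mem_sup.1 hu
  have e₁ : L.tanPart p (t + (n + w)) = t := by
    rw [map_add, tanPart, Submodule.projection_apply_of_mem_left h₁ ht,
      Submodule.projection_apply_of_mem_right h₁ hu, add_zero]
  have e₂ : L.ltrPart p (t + (n + w)) = n := by
    rw [add_left_comm, map_add, ltrPart, Submodule.projection_apply_of_mem_left h₂ hn,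
      Submodule.projection_apply_of_mem_right h₂ (Submodule.add_mem_sup ht hw), add_zero]
  have e₃ : L.screenTrPart p (t + (n + w)) = w := by
    rw [← add_assoc, add_comm, map_add, screenTrPart, Submodule.projection_apply_of_mem_left h₃ hw,
      Submodule.projection_apply_of_mem_right h₃ (Submodule.add_mem_sup ht hn), add_zero]
  rw [e₁, e₂, e₃]

theorem val_ltrPart (v : TangentSpace 𝓘(ℝ, E) (i p)) {ξ : TangentSpace 𝓘(ℝ, E) (i p)}
    (hξ : ξ ∈ radical E' g i p) : g.val (i p) (L.ltrPart p v) ξ = g.val (i p) v ξ := by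
  conv_rhs => rw [← L.parts_add v]
  have h := L.val_tangent_screenTr hξ.1 (L.screenTrPart_mem v)
  rw [g.symm] at h
  simp [val_radical (L.tanPart_mem v) hξ, h]

theorem val_screenTrPart (v : TangentSpace 𝓘(ℝ, E) (i p)) {W : TangentSpace 𝓘(ℝ, E) (i p)}
    (hW : W ∈ L.screenTr p) : g.val (i p) (L.screenTrPart p v) W = g.val (i p) v W := by
  conv_rhs => rw [← L.parts_add v]
  have h := L.val_screenTr_ltr hW (L.ltrPart_mem v)
  rw [g.symm] at h
  simp [L.val_tangent_screenTr (L.tanPart_mem v) hW, h]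

/-- The bundle `ltr` is null and orthogonal to both screens, so the radical is the only summand that
can pair nontrivially with it; nondegeneracy of the ambient metric concludes. -/
theorem eq_zero_of_mem_ltr {n : TangentSpace 𝓘(ℝ, E) (i p)} (hn : n ∈ L.ltr p)
    (h : ∀ ξ ∈ radical E' g i p, g.val (i p) n ξ = 0) : n = 0 := by
  refine g.nondegenerate (i p) n fun v ↦ ?_
  rw [← L.parts_add v]
  have ht := L.tanPart_mem v
  rw [← L.radical_sup_screen p] at ht
  obtain ⟨r, hr, s, hs, hrs⟩ := Submodule.mem_sup.1 ht
  have h₁ := L.val_screen_ltr hs hn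
  have h₂ := L.val_screenTr_ltr (L.screenTrPart_mem v) hn
  rw [g.symm] at h₁ h₂
  simp [← hrs, h r hr, h₁, h₂, L.ltr_null p n hn _ (L.ltrPart_mem v)]

theorem eq_zero_of_mem_screenTr {w : TangentSpace 𝓘(ℝ, E) (i p)} (hw : w ∈ L.screenTr p)
    (h : ∀ W ∈ L.screenTr p, g.val (i p) w W = 0) : w = 0 := by
  refine g.nondegenerate (i p) w fun v ↦ ?_
  rw [← L.parts_add v]
  have h₁ := L.val_tangent_screenTr (L.tanPart_mem v) hw
  rw [g.symm] at h₁
  simp [h₁, L.val_screenTr_ltr hw (L.ltrPart_mem v), h _ (L.screenTrPart_mem v)]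

theorem ltrPart_eq_zero_iff (v : TangentSpace 𝓘(ℝ, E) (i p)) :
    L.ltrPart p v = 0 ↔ ∀ ξ ∈ radical E' g i p, g.val (i p) v ξ = 0 := by
  refine ⟨fun h ξ hξ ↦ ?_, fun h ↦ L.eq_zero_of_mem_ltr (L.ltrPart_mem v) fun ξ hξ ↦ ?_⟩
  · rw [← L.val_ltrPart v hξ, h]; simp
  · rw [L.val_ltrPart v hξ, h ξ hξ]

theorem screenTrPart_eq_zero_iff (v : TangentSpace 𝓘(ℝ, E) (i p)) :
    L.screenTrPart p v = 0 ↔ ∀ W ∈ L.screenTr p, g.val (i p) v W = 0 := by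
  refine ⟨fun h W hW ↦ ?_, fun h ↦ L.eq_zero_of_mem_screenTr (L.screenTrPart_mem v) fun W hW ↦ ?_⟩
  · rw [← L.val_screenTrPart v hW, h]; simp
  · rw [L.val_screenTrPart v hW, h W hW]

theorem f_add_w (J : EndField E N) (V : FieldAlong E i) : L.f J V + L.w J V = applyEnd J V :=
  funext fun q ↦ L.parts_add (J (i q) (V q))

omit [FiniteDimensional ℝ E] in
theorem tangent_isSmoothSubbundle (L : LightlikeSubmanifold E' g i) :
    IsSmoothSubbundle E' (tangent E' i : SubspaceField E i) := by
  have h := L.radical_smooth.sup L.screen_smooth fun q ↦ disjoint_iff.2 (L.radical_inf_screen q)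
  rwa [show (fun q ↦ radical E' g i q ⊔ L.screen q) = (tangent E' i : SubspaceField E i) from
    funext L.radical_sup_screen] at h

theorem diffAlongAt_f {J : EndField E N} {V : FieldAlong E i}
    (h : DiffAlongAt E' (applyEnd J V) p) : DiffAlongAt E' (L.f J V) p := by
  have htr := L.ltr_smooth.sup L.screenTr_smooth fun q ↦
    (L.isCompl q).2.1.disjoint.mono_right le_sup_right
  exact DiffAlongAt.projection L.tangent_isSmoothSubbundle htr (fun q ↦ (L.isCompl q).1)
    L.contMDiff h

theorem diffAlongAt_w {J : EndField E N} {V : FieldAlong E i}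
    (h : DiffAlongAt E' (applyEnd J V) p) : DiffAlongAt E' (L.w J V) p := by
  rw [← add_sub_cancel_left (L.f J V) (L.w J V), f_add_w]
  exact h.sub (L.diffAlongAt_f h)

end Orthogonality

end LightlikeSubmanifold

/-! ### How $\bar J$ acts on the screen generic splitting. -/

namespace ScreenGeneric

variable {L : LightlikeSubmanifold E' g i} {J : EndField E N}

theorem apply_mem_radical (G : ScreenGeneric L J)
    {ξ : TangentSpace 𝓘(ℝ, E) (i p)} (hξ : ξ ∈ radical E' g i p) :
    J (i p) ξ ∈ radical E' g i p :=
  (G.map_radical p).le (Submodule.mem_map_of_mem hξ)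

theorem exists_apply_eq (G : ScreenGeneric L J)
    {ξ : TangentSpace 𝓘(ℝ, E) (i p)} (hξ : ξ ∈ radical E' g i p) :
    ∃ ζ ∈ radical E' g i p, J (i p) ζ = ξ :=
  (G.map_radical p).ge hξ

/-- If $b=\bar Js$ with both $b$ and $s$ in the screen, then $\bar Jb=3b+s$ is again in the screen;
so $B_o$ is invariant, and the radical is by assumption. -/
theorem apply_mem_B (G : ScreenGeneric L J)
    (hJ : ∀ (x : N) (u : TangentSpace 𝓘(ℝ, E) x), J x (J x u) = (3 : ℝ) • J x u + u)
    {x : TangentSpace 𝓘(ℝ, E) (i p)} (hx : x ∈ L.B J p) : J (i p) x ∈ L.B J p := by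
  obtain ⟨b, hb, r, hr, rfl⟩ := Submodule.mem_sup.1 hx
  rw [map_add]
  refine Submodule.add_mem_sup ?_ (G.apply_mem_radical hr)
  obtain ⟨⟨s, hs, rfl⟩, hb'⟩ := hb
  refine ⟨Submodule.mem_map_of_mem hb', ?_⟩
  change J (i p) (J (i p) s) ∈ _
  rw [hJ]
  exact Submodule.add_mem _ (Submodule.smul_mem _ _ hb') hs

/-! In the following, `J a = y + c₁ x + c₂ J x` with `x ∈ B`, as is the case for `a = Ω̄_X Z` and
`y = Ω̄_X (J Z)`. -/

section Pointwise

variable [FiniteDimensional ℝ E] {a x y : TangentSpace 𝓘(ℝ, E) (i p)} {c₁ c₂ : ℝ}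

/-- Self-adjointness gives $\bar g(a,\bar J\xi)=\bar g(y,\xi)$, and $\bar J\xi$ runs over the whole
radical as $\xi$ does. -/
theorem ltrPart_eq_zero_iff (G : ScreenGeneric L J)
    (hJ : ∀ (x : N) (u : TangentSpace 𝓘(ℝ, E) x), J x (J x u) = (3 : ℝ) • J x u + u)
    (hgJ : ∀ (x : N) (u v : TangentSpace 𝓘(ℝ, E) x), g.val x u (J x v) = g.val x (J x u) v)
    (hx : x ∈ L.B J p) (ha : J (i p) a = y + c₁ • x + c₂ • J (i p) x) :
    L.ltrPart p a = 0 ↔ L.ltrPart p y = 0 := by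
  have key : ∀ ξ ∈ radical E' g i p, g.val (i p) a (J (i p) ξ) = g.val (i p) y ξ := fun ξ hξ ↦ by
    rw [hgJ, ha]
    simp [LightlikeSubmanifold.val_radical (L.B_le_tangent J hx) hξ,
      LightlikeSubmanifold.val_radical (L.B_le_tangent J (G.apply_mem_B hJ hx)) hξ]
  rw [L.ltrPart_eq_zero_iff, L.ltrPart_eq_zero_iff]
  constructor
  · intro h ξ hξ
    rw [← key ξ hξ, h _ (G.apply_mem_radical hξ)]
  · intro h ξ hξ
    obtain ⟨ζ, hζ, rfl⟩ := G.exists_apply_eq hξ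
    rw [key ζ hζ, h ζ hζ]

omit [FiniteDimensional ℝ E] in
-- Write $W=\bar J(\bar JW)-3\bar JW$ and move one $\bar J$ onto $a$ in each term. The leftover
-- pairings are those of $x$, $\bar Jx$ and $\bar J^2x$ with $W$, all zero because $B$ is invariant
-- and tangent.
theorem val_screenTr_eq (G : ScreenGeneric L J)
    (hJ : ∀ (x : N) (u : TangentSpace 𝓘(ℝ, E) x), J x (J x u) = (3 : ℝ) • J x u + u)
    (hgJ : ∀ (x : N) (u v : TangentSpace 𝓘(ℝ, E) x), g.val x u (J x v) = g.val x (J x u) v)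
    (hx : x ∈ L.B J p) (ha : J (i p) a = y + c₁ • x + c₂ • J (i p) x)
    {W : TangentSpace 𝓘(ℝ, E) (i p)} (hW : W ∈ L.screenTr p) :
    g.val (i p) a W = g.val (i p) y (J (i p) W) - 3 * g.val (i p) y W := by
  have hB : ∀ z ∈ L.B J p, g.val (i p) z W = 0 := fun z hz ↦
    L.val_tangent_screenTr (L.B_le_tangent J hz) hW
  have h₁ := hB x hx
  have h₂ := hB _ (G.apply_mem_B hJ hx)
  have h₃ := hB _ (G.apply_mem_B hJ (G.apply_mem_B hJ hx))
  have hWJ : W = J (i p) (J (i p) W) - (3 : ℝ) • J (i p) W := by rw [hJ]; abel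
  have e₁ : g.val (i p) a (J (i p) W) = g.val (i p) y W := by
    rw [hgJ, ha]; simp [h₁, h₂]
  have e₂ : g.val (i p) a (J (i p) (J (i p) W)) = g.val (i p) y (J (i p) W) := by
    rw [hgJ, ha]; simp [hgJ _ x, hgJ _ (J (i p) x), h₂, h₃]
  rw [← e₁, ← e₂]
  conv_lhs => rw [hWJ]
  simp

/-- Against $\xi$ in the radical, $\bar g(\bar JW,\xi)=\bar g(W,\bar J\xi)=0$, because $\bar J\xi$
is tangent to $M$. -/
theorem ltrPart_apply_screenTr (G : ScreenGeneric L J)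
    (hgJ : ∀ (x : N) (u v : TangentSpace 𝓘(ℝ, E) x), g.val x u (J x v) = g.val x (J x u) v)
    {W : TangentSpace 𝓘(ℝ, E) (i p)} (hW : W ∈ L.screenTr p) :
    L.ltrPart p (J (i p) W) = 0 := by
  rw [L.ltrPart_eq_zero_iff]
  intro ξ hξ
  rw [← hgJ, g.symm, L.val_tangent_screenTr (G.apply_mem_radical hξ).1 hW]

/-- The screen transversal condition of the theorem, for `y = b + c`. -/
theorem screenTr_condition_iff (G : ScreenGeneric L J)
    (hJ : ∀ (x : N) (u : TangentSpace 𝓘(ℝ, E) x), J x (J x u) = (3 : ℝ) • J x u + u)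
    (hgJ : ∀ (x : N) (u v : TangentSpace 𝓘(ℝ, E) x), g.val x u (J x v) = g.val x (J x u) v)
    {b c : TangentSpace 𝓘(ℝ, E) (i p)}
    (hx : x ∈ L.B J p) (ha : J (i p) a = (b + c) + c₁ • x + c₂ • J (i p) x)
    (h0 : L.ltrPart p (b + c) = 0)
    {W : TangentSpace 𝓘(ℝ, E) (i p)} (hW : W ∈ L.screenTr p) :
    3 * g.val (i p) (L.screenTrPart p b + L.screenTrPart p c) W
        + g.val (i p) (-L.tanPart p c) (L.tanPart p (J (i p) W))
      = g.val (i p) (L.tanPart p b + L.screenTrPart p b) (J (i p) W)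
        + g.val (i p) (L.screenTrPart p c)
          (L.ltrPart p (J (i p) W) + L.screenTrPart p (J (i p) W))
      ↔ g.val (i p) a W = 0 := by
  rw [G.val_screenTr_eq hJ hgJ hx ha hW, G.ltrPart_apply_screenTr hgJ hW]
  have hb := congrArg (fun v ↦ g.val (i p) v (J (i p) W)) (L.parts_add b)
  have hc := congrArg (fun v ↦ g.val (i p) v (J (i p) W)) (L.parts_add c)
  have ht := congrArg (fun v ↦ g.val (i p) (L.tanPart p c) v) (L.parts_add (J (i p) W))
  have hs := congrArg (fun v ↦ g.val (i p) (L.screenTrPart p c) v) (L.parts_add (J (i p) W))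
  have hn := congrArg (fun v ↦ g.val (i p) v (J (i p) W)) h0
  have o₁ := L.val_tangent_screenTr (L.tanPart_mem c) (L.screenTrPart_mem (J (i p) W))
  have o₂ := L.val_tangent_screenTr (L.tanPart_mem (J (i p) W)) (L.screenTrPart_mem c)
  rw [g.symm] at o₂
  simp only [G.ltrPart_apply_screenTr hgJ hW, map_add, map_neg, add_apply, neg_apply, map_zero,
    zero_apply, zero_add, L.val_screenTrPart _ hW, o₁, o₂] at hb hc ht hs hn ⊢
  -- The `ltr` parts of `b` and `c` contribute to $\bar g(b+c,\bar JW)$ only through their sum,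
  -- which `h0` kills; `ht` and `hs` replace $\bar JW$ by $fW$ and $wW$ against the two parts of
  -- `c`.
  constructor <;> intro h <;> linarith

end Pointwise

end ScreenGeneric

/-- `J` applied to `Ω̄_X V`, for the `(l,m)`-type connection `Ω̄`. -/
theorem apply_covAlong_lmConnection [FiniteDimensional ℝ E] {J : EndField E N}
    {cov : AffineConnection E N}
    (hN : IsLocallyBronze g J cov) (l m : N → ℝ) (η : (x : N) → TangentSpace 𝓘(ℝ, E) x)
    (hi : MDifferentiableAt 𝓘(ℝ, E') 𝓘(ℝ, E) i p) {V : FieldAlong E i} (hV : DiffAlongAt E' V p)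
    (v : TangentSpace 𝓘(ℝ, E') p) (x : TangentSpace 𝓘(ℝ, E) (i p))
    (hx : x = mfderiv 𝓘(ℝ, E') 𝓘(ℝ, E) i p v) :
    J (i p) (covAlong (lmConnection g J cov l m η) i V p v)
      = covAlong (lmConnection g J cov l m η) i (applyEnd J V) p v
        + (theta g η (i p) (V p) * m (i p) - theta g η (i p) (J (i p) (V p)) * l (i p)) • x
        + (theta g η (i p) (V p) * (l (i p) + 3 * m (i p))
          - theta g η (i p) (J (i p) (V p)) * m (i p)) • J (i p) x := by
  rw [covAlong_lmConnection _ _ _ _ _ _ hi.continuousAt, covAlong_lmConnection _ _ _ _ _ _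
    hi.continuousAt, covAlong_applyEnd cov hi hN.contMDiff hN.parallel hV, ← hx]
  simp only [map_add, map_smul, hN.bronze, applyEnd]
  module

end Lightlike

end LightlikeBronze

/-! ### The characterization of mixed geodesic submanifolds. -/

theorem mainTheorem10
    {E : Type*} [NormedAddCommGroup E] [NormedSpace ℝ E] [FiniteDimensional ℝ E]
    {N : Type*} [TopologicalSpace N] [T2Space N] [ChartedSpace E N] [IsManifold 𝓘(ℝ, E) ∞ N]
    {E' : Type*} [NormedAddCommGroup E'] [NormedSpace ℝ E'] [FiniteDimensional ℝ E']
    {M : Type*} [TopologicalSpace M] [T2Space M] [ChartedSpace E' M] [IsManifold 𝓘(ℝ, E') ∞ M]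
    (g : SemiRiemannianMetric E N) (J : EndField E N) (nabla : AffineConnection E N)
    (hN : IsLocallyBronze g J nabla)
    (l m : N → ℝ) (η : (x : N) → TangentSpace 𝓘(ℝ, E) x) (hlm : IsLMData g l m η)
    (Ω : AffineConnection E N) (hΩ : Ω = lmConnection g J nabla l m η)
    (i : M → N) (L : LightlikeSubmanifold E' g i) (G : ScreenGeneric L J) :
    IsMixedGeodesic G Ω ↔
      (∀ (X : (p : M) → TangentSpace 𝓘(ℝ, E') p) (Z ξ : FieldAlong E i),
        IsTangentSection (L.B J) X → IsSection E' G.B' Z → IsSection E' (radical E' g i) ξ →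
        ∀ p : M,
          pairing g (L.hl Ω X (L.f J Z)) ξ p
              + l (i p) * thetaAlong g η Z p * pairing g (applyEnd J (push i X)) ξ p
              + 3 * m (i p) * thetaAlong g η Z p * pairing g (applyEnd J (push i X)) ξ p
              + m (i p) * thetaAlong g η Z p * pairing g (push i X) ξ p
            = -pairing g (L.Dl Ω X (L.w J Z)) ξ p
              + l (i p) * thetaAlong g η (applyEnd J Z) p * pairing g (push i X) ξ p
              + m (i p) * thetaAlong g η (applyEnd J Z) p
                  * pairing g (applyEnd J (push i X)) ξ p) ∧
      (∀ (X : (p : M) → TangentSpace 𝓘(ℝ, E') p) (Z W : FieldAlong E i),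
        IsTangentSection (L.B J) X → IsSection E' G.B' Z → IsSection E' L.screenTr W →
        ∀ p : M,
          3 * pairing g (L.hs Ω X (L.f J Z) + L.screenConn Ω X (L.w J Z)) W p
              + pairing g (L.shape Ω X (L.w J Z)) (L.f J W) p
            = pairing g (L.induced Ω X (L.f J Z) + L.hs Ω X (L.f J Z)) (applyEnd J W) p
              + pairing g (L.screenConn Ω X (L.w J Z)) (L.w J W) p) := by
  subst hΩ
  have hi := L.contMDiff
  have hid : ∀ p, MDifferentiableAt 𝓘(ℝ, E') 𝓘(ℝ, E) i p := fun p ↦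
    (hi p).mdifferentiableAt (by simp)
  set Ω := lmConnection g J nabla l m η with hΩ
  have main : ∀ (X : (p : M) → TangentSpace 𝓘(ℝ, E') p) (Z : FieldAlong E i),
      IsTangentSection (L.B J) X → IsSection E' G.B' Z → ∀ p : M, ∃ c₁ c₂ : ℝ,
        J (i p) (covAlong Ω i Z p (X p))
          = (covAlong Ω i (L.f J Z) p (X p) + covAlong Ω i (L.w J Z) p (X p))
            + c₁ • push i X p + c₂ • J (i p) (push i X p) := by
    intro X Z hX hZ p
    have hZd := hZ.diffAlongAt hi p
    have hJZ : DiffAlongAt E' (applyEnd J Z) p := hZd.applyEnd (hid p) hN.contMDiff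
    rw [← covAlong_add Ω (hid p).continuousAt (L.diffAlongAt_f hJZ) (L.diffAlongAt_w hJZ),
      L.f_add_w]
    exact ⟨_, _, apply_covAlong_lmConnection hN l m η (hid p) hZd (X p) (push i X p) rfl⟩
  have first : ∀ (X : (p : M) → TangentSpace 𝓘(ℝ, E') p) (Z : FieldAlong E i),
      IsTangentSection (L.B J) X → IsSection E' G.B' Z → ∀ p : M,
        (L.hl Ω X Z p = 0 ↔
          L.ltrPart p (covAlong Ω i (L.f J Z) p (X p) + covAlong Ω i (L.w J Z) p (X p)) = 0) := by
    intro X Z hX hZ p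
    obtain ⟨c₁, c₂, h⟩ := main X Z hX hZ p
    exact G.ltrPart_eq_zero_iff hN.bronze hN.compatible (hX.2 p) h
  have second : ∀ (X : (p : M) → TangentSpace 𝓘(ℝ, E') p) (Z ξ : FieldAlong E i),
      IsTangentSection (L.B J) X → IsSection E' (radical E' g i) ξ → ∀ p : M,
        ((pairing g (L.hl Ω X (L.f J Z)) ξ p
              + l (i p) * thetaAlong g η Z p * pairing g (applyEnd J (push i X)) ξ p
              + 3 * m (i p) * thetaAlong g η Z p * pairing g (applyEnd J (push i X)) ξ p
              + m (i p) * thetaAlong g η Z p * pairing g (push i X) ξ p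
            = -pairing g (L.Dl Ω X (L.w J Z)) ξ p
              + l (i p) * thetaAlong g η (applyEnd J Z) p * pairing g (push i X) ξ p
              + m (i p) * thetaAlong g η (applyEnd J Z) p
                  * pairing g (applyEnd J (push i X)) ξ p)
          ↔ g.val (i p) (covAlong Ω i (L.f J Z) p (X p) + covAlong Ω i (L.w J Z) p (X p)) (ξ p)
            = 0) := by
    intro X Z ξ hX hξ p
    -- Every $\theta$-term of (i) carries one of the two factors shown here to vanish.
    have e₁ : pairing g (push i X) ξ p = 0 :=
      LightlikeSubmanifold.val_radical (L.B_le_tangent J (hX.2 p)) (hξ.2 p)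
    have e₂ : pairing g (applyEnd J (push i X)) ξ p = 0 :=
      LightlikeSubmanifold.val_radical
        (L.B_le_tangent J (G.apply_mem_B hN.bronze (hX.2 p))) (hξ.2 p)
    have e₃ : pairing g (L.hl Ω X (L.f J Z)) ξ p
        = g.val (i p) (covAlong Ω i (L.f J Z) p (X p)) (ξ p) := L.val_ltrPart _ (hξ.2 p)
    have e₄ : pairing g (L.Dl Ω X (L.w J Z)) ξ p
        = g.val (i p) (covAlong Ω i (L.w J Z) p (X p)) (ξ p) := L.val_ltrPart _ (hξ.2 p)
    rw [e₁, e₂, e₃, e₄, map_add, add_apply]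
    constructor <;> intro h <;> linarith
  constructor
  · intro h
    refine ⟨fun X Z ξ hX hZ hξ p ↦ (second X Z ξ hX hξ p).2 ?_, fun X Z W hX hZ hW p ↦ ?_⟩
    · exact (L.ltrPart_eq_zero_iff _).1 ((first X Z hX hZ p).1 (h X Z hX hZ p).1) _ (hξ.2 p)
    · obtain ⟨c₁, c₂, ha⟩ := main X Z hX hZ p
      exact (G.screenTr_condition_iff hN.bronze hN.compatible (hX.2 p) ha
        ((first X Z hX hZ p).1 (h X Z hX hZ p).1) (hW.2 p)).2
        ((L.screenTrPart_eq_zero_iff _).1 (h X Z hX hZ p).2 _ (hW.2 p))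
  · rintro ⟨h₁, h₂⟩ X Z hX hZ p
    have h0 : L.ltrPart p
        (covAlong Ω i (L.f J Z) p (X p) + covAlong Ω i (L.w J Z) p (X p)) = 0 := by
      refine (L.ltrPart_eq_zero_iff _).2 fun ξ hξ ↦ ?_
      -- The hypothesis speaks of global sections, so the single vector `ξ` is extended to one.
      obtain ⟨V, hV, rfl⟩ := L.radical_smooth.exists_section hi hξ
      exact (second X Z V hX hV p).1 (h₁ X Z V hX hZ hV p)
    refine ⟨(first X Z hX hZ p).2 h0, (L.screenTrPart_eq_zero_iff _).2 fun W hW ↦ ?_⟩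
    obtain ⟨V, hV, rfl⟩ := L.screenTr_smooth.exists_section hi hW
    obtain ⟨c₁, c₂, ha⟩ := main X Z hX hZ p
    exact (G.screenTr_condition_iff hN.bronze hN.compatible (hX.2 p) ha h0 (hV.2 p)).1
      (h₂ X Z V hX hZ hV p)
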